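/- Let $\Gamma$ be a compact connected metric graph with finite vertex set $\mathcal V$ and finite nonempty edge set $\mathcal E$ (loops and multiple edges allowed). Each edge $e$ is identified with an interval $[0,l_e]$, $0<l_e<\infty$, and $\Gamma$ carries the shortest path distance. For $v\in\mathcal V$ let $d_v$ be its degree (a loop counts twice), and put $d_0=\min_{v}d_v$, $l_{\min}=\min_e l_e$, $l_{\max}=\max_e l_e$. Let $\mathrm H:\Gamma\to\mathbb R$ be Lipschitz with $\mathrm H\ge \mathrm H_0>0$ on $\Gamma$, let $\kappa\in L_\infty(\Gamma)$ satisfy $\operatorname{ess\,inf}_\Gamma\kappa\ge\kappa_0>0$, and let $\alpha\in\mathbb R$. Let $L$ be the operator in $L_2(\Gamma)=\bigoplus_{e}L_2(0,l_e)$ given on each edge by $$Lu=-(\mathrm H u')'+\kappa^2u ,$$ whose domain consists of the functions $u\in\bigoplus_e H^2(0,l_e)$ that satisfy the generalized Kirchhoff conditions: $u$ is continuous on $\Gamma$ and $$\mathrm H(v)\sum_{e\in\mathcal E_v}\partial_eu(v)=\alpha u(v)\qquad\text{for all }v\in\mathcal V,$$ where $\partial_e u(v)$ is the derivative of $u$ along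 $e$ at $v$ in the direction away from $v$, and the sum runs over the edge ends at $v$ (so a loop at $v$ contributes two terms). Assume that either $\alpha\ge 0$, or, with $S=|\alpha|/d_0$, $$\kappa_0^2>4S\,l_{\min}^{-1}\quad\text{and}\quad 2S\,l_{\max}\le \mathrm H_0 .$$ Then $L_2(\Gamma)$ has a complete orthonormal system of eigenfunctions of $L$ whose eigenvalues, counted with multiplicity, can be ordered as $\lambda_1\le\lambda_2\le\cdots$, and there are constants $C_1,C_2>0$ such that $$C_1n^2\le\lambda_n\le C_2n^2\qquad\text{for all }n\in\mathbb N=\{1,2,\dots\}.$$ -/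

import Mathlib

open MeasureTheory Set
open scoped ContDiff

/-- A metric graph with vertices `V` and edges `E`, loops and multiple edges allowed. The edge `e` is
identified with the interval `[0, len e]`; its end `0` (labelled `false`) is attached to the vertex
`endpt e false` and its end `len e` (labelled `true`) to the vertex `endpt e true`. -/
structure MetricGraph (V E : Type*) where
  endpt : E → Bool → V
  len : E → ℝ
  len_pos : ∀ e, 0 < len e

/-- Lebesgue measure on an edge `[0, l]`. -/
noncomputable abbrev edgeMeasure (l : ℝ) : Measure ℝ := volume.restrict (Icc 0 l)

/-- `f` belongs to `H¹(0, l)` and `g` is its weak derivative: both are square integrable and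
`∫ f φ' = - ∫ g φ` for all smooth `φ` with compact support in `(0, l)`. -/
structure HasSobolevDeriv (l : ℝ) (f g : ℝ → ℝ) : Prop where
  memLp : MemLp f 2 (edgeMeasure l)
  memLp_deriv : MemLp g 2 (edgeMeasure l)
  integral_eq : ∀ φ : ℝ → ℝ, ContDiff ℝ ∞ φ → HasCompactSupport φ → tsupport φ ⊆ Ioo 0 l →
    ∫ x in Icc 0 l, f x * deriv φ x = - ∫ x in Icc 0 l, g x * φ x

/-- `u` belongs to `H²(0, l)` with first derivative `p`, where `u` and `p` are the representatives
that are continuous on `[0, l]`. Every class in `H²(0, l)` has them, since `H²(0, l) ⊆ C¹([0, l])`;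
their values at the ends of the edge are those that enter the vertex conditions. -/
structure IsH2Rep (l : ℝ) (u p : ℝ → ℝ) : Prop where
  continuousOn : ContinuousOn u (Icc 0 l)
  continuousOn_deriv : ContinuousOn p (Icc 0 l)
  hasDeriv : HasSobolevDeriv l u p
  hasDeriv₂ : ∃ q : ℝ → ℝ, HasSobolevDeriv l p q

namespace MetricGraph

/-- Any two vertices are joined by a chain of edges. -/
def Connected {V E : Type*} (Γ : MetricGraph V E) : Prop :=
  ∀ v w : V, Relation.EqvGen (fun a b => ∃ e, Γ.endpt e false = a ∧ Γ.endpt e true = b) v w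

/-- The vertex to which an edge end is attached. -/
def vertex {V E : Type*} (Γ : MetricGraph V E) (h : E × Bool) : V := Γ.endpt h.1 h.2

/-- The coordinate, `0` or `len e`, of an end of the edge `e`. -/
def endCoord {V E : Type*} (Γ : MetricGraph V E) : E × Bool → ℝ
  | (_, false) => 0
  | (e, true) => Γ.len e

open Classical in
/-- The edge ends attached to the vertex `v`; a loop at `v` contributes both its ends. -/
noncomputable def star {V E : Type*} [Fintype E] (Γ : MetricGraph V E) (v : V) :
    Finset (E × Bool) :=
  Finset.univ.filter fun h => Γ.vertex h = v

/-- The degree `d_v` of a vertex; a loop counts twice. -/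
noncomputable def degree {V E : Type*} [Fintype E] (Γ : MetricGraph V E) (v : V) : ℕ :=
  (Γ.star v).card

/-- The minimal degree `d_0`. -/
noncomputable def minDegree {V E : Type*} [Fintype E] (Γ : MetricGraph V E) : ℕ :=
  ⨅ v, Γ.degree v

/-- The length of a shortest edge. -/
noncomputable def lenMin {V E : Type*} (Γ : MetricGraph V E) : ℝ := ⨅ e, Γ.len e

/-- The length of a longest edge. -/
noncomputable def lenMax {V E : Type*} (Γ : MetricGraph V E) : ℝ := ⨆ e, Γ.len e

/-- The locations of `Γ`: pairs `(e, t)` with `t ∈ [0, len e]`. Ends of edges that are attached to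
the same vertex are one point of `Γ`. -/
def points {V E : Type*} (Γ : MetricGraph V E) : Set (E × ℝ) :=
  {x | x.2 ∈ Icc 0 (Γ.len x.1)}

/-- `Γ.HasPath x y r`: there is a path of length `r` in `Γ` from `x` to `y`. -/
inductive HasPath {V E : Type*} (Γ : MetricGraph V E) : E × ℝ → E × ℝ → ℝ → Prop
  | along (e : E) (s t : ℝ) (hs : s ∈ Icc 0 (Γ.len e)) (ht : t ∈ Icc 0 (Γ.len e)) :
      HasPath Γ (e, s) (e, t) |s - t|
  | through (h h' : E × Bool) (hv : Γ.vertex h = Γ.vertex h') :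
      HasPath Γ (h.1, Γ.endCoord h) (h'.1, Γ.endCoord h') 0
  | concat (x y z : E × ℝ) (r r' : ℝ) (hxy : HasPath Γ x y r) (hyz : HasPath Γ y z r') :
      HasPath Γ x z (r + r')

/-- The shortest path distance. -/
noncomputable def pathDist {V E : Type*} (Γ : MetricGraph V E) (x y : E × ℝ) : ℝ :=
  sInf {r | Γ.HasPath x y r}

/-- Functions on `Γ` are given edge by edge, as `f : E → ℝ → ℝ`, of which only the values `f e t` with
`t ∈ [0, len e]` matter. `f` is Lipschitz for the shortest path distance; in particular its values
at edge ends that are attached to the same vertex agree. -/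
def IsLipschitz {V E : Type*} (Γ : MetricGraph V E) (f : E → ℝ → ℝ) : Prop :=
  ∃ K : ℝ, 0 ≤ K ∧ ∀ x ∈ Γ.points, ∀ y ∈ Γ.points,
    |f x.1 x.2 - f y.1 y.2| ≤ K * Γ.pathDist x y

/-- The value of `f` at an edge end. -/
noncomputable def endValue {V E : Type*} (Γ : MetricGraph V E) (f : E → ℝ → ℝ) (h : E × Bool) : ℝ :=
  f h.1 (Γ.endCoord h)

/-- The derivative at an edge end in the direction away from the vertex, for a function with
derivative `p`: `p e 0` at the end `0`, and `- p e (len e)` at the end `len e`. -/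
noncomputable def outDeriv {V E : Type*} (Γ : MetricGraph V E) (p : E → ℝ → ℝ) : E × Bool → ℝ
  | (e, false) => p e 0
  | (e, true) => - p e (Γ.len e)

/-- The generalized Kirchhoff conditions for `u` with derivative `p`: `u` is continuous at every
vertex `v`, and `H(v) ∑_{e ∈ E_v} ∂_e u(v) = α u(v)`. -/
structure IsKirchhoff {V E : Type*} [Fintype E] (Γ : MetricGraph V E) (H : E → ℝ → ℝ) (α : ℝ)
    (u p : E → ℝ → ℝ) : Prop where
  continuous_at_vertex : ∀ h h' : E × Bool, Γ.vertex h = Γ.vertex h' →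
    Γ.endValue u h = Γ.endValue u h'
  flux : ∀ v : V, ∀ h ∈ Γ.star v,
    Γ.endValue H h * ∑ h' ∈ Γ.star v, Γ.outDeriv p h' = α * Γ.endValue u h

/-- The Hilbert space `L₂(Γ) = ⨁ₑ L₂(e)`. -/
noncomputable abbrev L2 {V E : Type*} [Fintype E] (Γ : MetricGraph V E) : Type _ :=
  PiLp 2 fun e : E => Lp ℝ 2 (edgeMeasure (Γ.len e))

/-- The graph of the operator `L u = -(H u')' + κ² u` with generalized Kirchhoff conditions:
`u ∈ D(L)`, that is, `u` is in `H²` on every edge and satisfies the vertex conditions, and `L u = f`. -/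
def OperatorEq {V E : Type*} [Fintype E] (Γ : MetricGraph V E) (H κ : E → ℝ → ℝ) (α : ℝ)
    (u f : Γ.L2) : Prop :=
  ∃ u₀ p r : E → ℝ → ℝ,
    (∀ e, u e =ᵐ[edgeMeasure (Γ.len e)] u₀ e) ∧
    (∀ e, IsH2Rep (Γ.len e) (u₀ e) (p e)) ∧
    Γ.IsKirchhoff H α u₀ p ∧
    (∀ e, HasSobolevDeriv (Γ.len e) (fun x => H e x * p e x) (r e)) ∧
    (∀ e, f e =ᵐ[edgeMeasure (Γ.len e)] fun x => - r e x + κ e x ^ 2 * u₀ e x)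

/-- `ev 0 ≤ ev 1 ≤ …` are the eigenvalues of `L`, repeated according to multiplicity: they belong to
a complete orthonormal system of eigenfunctions of `L` in `L₂(Γ)`. -/
def IsOrderedEigenvalues {V E : Type*} [Fintype E] (Γ : MetricGraph V E) (H κ : E → ℝ → ℝ) (α : ℝ)
    (ev : ℕ → ℝ) : Prop :=
  Monotone ev ∧ ∃ b : ℕ → Γ.L2, Orthonormal ℝ b ∧
    (Submodule.span ℝ (range b)).topologicalClosure = ⊤ ∧
    ∀ n, Γ.OperatorEq H κ α (b n) (ev n • b n)

/-- The edge lengths satisfy `κ₀² > 4 S / l_min` and `2 S l_max ≤ H₀`. -/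
def EdgeLengthCondition {V E : Type*} (Γ : MetricGraph V E) (S κ₀ H₀ : ℝ) : Prop :=
  κ₀ ^ 2 > 4 * S * (Γ.lenMin)⁻¹ ∧ 2 * S * Γ.lenMax ≤ H₀

end MetricGraph

/-! The operator is governed by the quadratic form `∑ₑ ∫ (H u'² + κ² u²) + α ∑ᵥ u(v)²` on the
functions that are `H¹` on every edge and continuous at the vertices. Integration by parts makes `L
u = f` equivalent to its weak form (`OperatorEq.exists_weak`, `operatorEq_of_weak`): the Kirchhoff
conditions are the natural boundary conditions of the form. Eigenvalues of `L` are therefore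
eigenvalues of the form relative to the `L₂` inner product.

A negative vertex term is absorbed edge by edge through a trace inequality with a free parameter `δ`
(`IsPrimitive.sq_add_sq_le`). The edge length condition is what leaves a positive margin for some
`δ` above `1` (`EdgeLengthCondition.exists_margin`), and `form_lower_bound` then gives coercivity in
`H¹`.

The growth rate comes from min-max with explicit subspaces. A function with `N` equidistant zeros on
every edge satisfies a Poincaré inequality with constant `l_max / N`, so the form is at least a
multiple of `N²` on a space of codimension `|E| N` (`exists_lower_bound_codim`). The first `n` sine
functions on a single edge span a space on which the form is at most a multiple of `n²`
(`exists_upper_bound_dim`). `IsFormEigensystem.le_ev` and `IsFormEigensystem.ev_le` turn these into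
bounds for eigenvalues.

The lower bound also makes the inclusion into `L₂` compact. The solution operator of the form is
then compact, symmetric and positive, and its eigenvectors give the complete system
(`exists_isFormEigensystem`). -/

/-! ### Spectral theory of a coercive symmetric form. -/

section FormEigenvalues

open scoped InnerProductSpace

variable {W X : Type*} [NormedAddCommGroup W] [InnerProductSpace ℝ W] [NormedAddCommGroup X]
  [InnerProductSpace ℝ X]

/-- `w n` are eigenvectors, with eigenvalues `ev n`, of the bilinear form `B` relative to the inner
product pulled back along `J`, and they are orthonormal for the latter. -/
structure IsFormEigensystem (J : W →L[ℝ] X) (B : W →L[ℝ] W →L[ℝ] ℝ) (ev : ℕ → ℝ) (w : ℕ → W) :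
    Prop where
  orthonormal : Orthonormal ℝ fun n => J (w n)
  form_eq : ∀ n v, B (w n) v = ev n * ⟪J (w n), J v⟫_ℝ

variable {J : W →L[ℝ] X} {B : W →L[ℝ] W →L[ℝ] ℝ} {ev : ℕ → ℝ} {w : ℕ → W}

theorem IsFormEigensystem.form_self (h : IsFormEigensystem J B ev w) (i j : ℕ) :
    B (w i) (w j) = if i = j then ev i else 0 := by
  rw [h.form_eq, orthonormal_iff_ite.mp h.orthonormal]
  split_ifs <;> simp

theorem IsFormEigensystem.form_sum_right (h : IsFormEigensystem J B ev w) (s : Finset ℕ)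
    (c : ℕ → ℝ) {i : ℕ} (hi : i ∈ s) : B (w i) (∑ j ∈ s, c j • w j) = ev i * c i := by
  simp [map_sum, h.form_self, hi, mul_comm]

theorem IsFormEigensystem.form_sum (h : IsFormEigensystem J B ev w) (s : Finset ℕ) (c : ℕ → ℝ) :
    B (∑ j ∈ s, c j • w j) (∑ j ∈ s, c j • w j) = ∑ i ∈ s, ev i * c i ^ 2 := by
  rw [map_sum B, sum_apply]
  refine Finset.sum_congr rfl fun i hi => ?_
  rw [map_smul, smul_apply, h.form_sum_right s c hi, smul_eq_mul]
  ring

theorem IsFormEigensystem.norm_sum_sq (h : IsFormEigensystem J B ev w) (s : Finset ℕ) (c : ℕ → ℝ) :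
    ‖J (∑ j ∈ s, c j • w j)‖ ^ 2 = ∑ i ∈ s, c i ^ 2 := by
  rw [← real_inner_self_eq_norm_sq, map_sum]
  simp_rw [map_smul]
  rw [h.orthonormal.inner_sum]
  simp [sq]

/-- Bessel's inequality for the form. -/
theorem IsFormEigensystem.sum_le_form (h : IsFormEigensystem J B ev w)
    (hsymm : ∀ u v, B u v = B v u) (hpos : ∀ u, 0 ≤ B u u) (u : W) (s : Finset ℕ) :
    ∑ i ∈ s, ev i * ⟪J (w i), J u⟫_ℝ ^ 2 ≤ B u u := by
  set c : ℕ → ℝ := fun i => ⟪J (w i), J u⟫_ℝ with hc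
  -- The form at the remainder of the partial expansion equals `B u u` minus the sum in question.
  have h1 := hpos (u - ∑ j ∈ s, c j • w j)
  have h3 := hsymm u (∑ j ∈ s, c j • w j)
  have h2 : B (∑ j ∈ s, c j • w j) u = ∑ i ∈ s, ev i * c i ^ 2 := by
    rw [map_sum, sum_apply]
    refine Finset.sum_congr rfl fun i _ => ?_
    rw [map_smul, smul_apply, h.form_eq, smul_eq_mul]
    simp only [hc]; ring
  rw [map_sub B, sub_apply, map_sub, map_sub, h3, h2, h.form_sum] at h1
  linarith

/-- If the form is at least `c` times the squared norm on the kernel of fewer than `n` functionals,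
then the `n`-th eigenvalue is at least `c`. -/
theorem IsFormEigensystem.le_ev (h : IsFormEigensystem J B ev w) (hmono : Monotone ev) {n : ℕ}
    {F : Type*} [AddCommGroup F] [Module ℝ F] [FiniteDimensional ℝ F] (P : W →ₗ[ℝ] F)
    (hP : Module.finrank ℝ F < n) {c : ℝ} (hc : ∀ u, P u = 0 → c * ‖J u‖ ^ 2 ≤ B u u) :
    c ≤ ev (n - 1) := by
  -- Some nonzero combination of the first `n` eigenvectors is killed by `P`, and on such
  -- combinations the Rayleigh quotient is at most `ev (n - 1)`.
  let Φ : (Fin n → ℝ) →ₗ[ℝ] W := Fintype.linearCombination ℝ fun i : Fin n => w i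
  obtain ⟨x, hx, hx0⟩ : ∃ x, (P ∘ₗ Φ) x = 0 ∧ x ≠ 0 := by
    have := LinearMap.ker_ne_bot_of_finrank_lt (f := P ∘ₗ Φ) (by simpa using hP)
    obtain ⟨x, hx, hx0⟩ := (Submodule.ne_bot_iff _).mp this
    exact ⟨x, hx, hx0⟩
  let y : ℕ → ℝ := fun i => if hi : i < n then x ⟨i, hi⟩ else 0
  have hΦ : Φ x = ∑ i ∈ Finset.range n, y i • w i := by
    simp only [Φ, Fintype.linearCombination_apply, Finset.sum_range, y]
    exact Finset.sum_congr rfl fun i _ => by simp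
  have h1 := hc (Φ x) hx
  rw [hΦ, h.form_sum, h.norm_sum_sq] at h1
  have h2 : ∑ i ∈ Finset.range n, ev i * y i ^ 2 ≤ ev (n - 1) * ∑ i ∈ Finset.range n, y i ^ 2 := by
    rw [Finset.mul_sum]
    refine Finset.sum_le_sum fun i hi => mul_le_mul_of_nonneg_right (hmono ?_) (sq_nonneg _)
    have := Finset.mem_range.mp hi
    omega
  have h3 : 0 < ∑ i ∈ Finset.range n, y i ^ 2 := by
    obtain ⟨i, hi⟩ := Function.ne_iff.mp hx0
    refine Finset.sum_pos' (fun _ _ => sq_nonneg _) ⟨i, Finset.mem_range.mpr i.2, ?_⟩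
    have : y i = x i := by simp [y]
    rw [this]
    have hi' : x i ≠ 0 := hi
    positivity
  exact le_of_mul_le_mul_right (h1.trans h2) h3

/-- If the form is at most `c` times the squared norm on an `n`-dimensional space, then the `n`-th
eigenvalue of a complete eigensystem is at most `c`. -/
theorem IsFormEigensystem.ev_le [CompleteSpace X] (h : IsFormEigensystem J B ev w)
    (hmono : Monotone ev)
    (hcomplete : (Submodule.span ℝ (range fun n => J (w n))).topologicalClosure = ⊤)
    (hsymm : ∀ u v, B u v = B v u) (hpos : ∀ u, 0 ≤ B u u) {n : ℕ} (hn : 1 ≤ n)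
    (Φ : (Fin n → ℝ) →ₗ[ℝ] W) (hΦ : ∀ x, J (Φ x) = 0 → x = 0) {c : ℝ}
    (hc : ∀ x, B (Φ x) (Φ x) ≤ c * ‖J (Φ x)‖ ^ 2) : ev (n - 1) ≤ c := by
  -- There are `n` dimensions and only `n - 1` conditions, so some nonzero vector of the space is
  -- orthogonal to the first `n - 1` eigenvectors.
  let P : (Fin n → ℝ) →ₗ[ℝ] (Fin (n - 1) → ℝ) :=
    LinearMap.pi fun i => (innerSL ℝ (J (w i))).toLinearMap ∘ₗ J.toLinearMap ∘ₗ Φ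
  obtain ⟨x, hx, hx0⟩ : ∃ x, P x = 0 ∧ x ≠ 0 := by
    have := LinearMap.ker_ne_bot_of_finrank_lt (f := P) (by simp; omega)
    obtain ⟨x, hx, hx0⟩ := (Submodule.ne_bot_iff _).mp this
    exact ⟨x, hx, hx0⟩
  set u := Φ x with hu
  have hzero : ∀ i < n - 1, ⟪J (w i), J u⟫_ℝ = 0 := fun i hi => by
    simpa [P] using congrFun hx ⟨i, hi⟩
  -- Completeness enters through Parseval's identity, which is compared with Bessel's inequality for
  -- the form.
  let b : HilbertBasis ℕ ℝ X := HilbertBasis.mk h.orthonormal hcomplete.ge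
  have hb : ∀ i, b i = J (w i) := fun i => by simp [b]
  have hsum : HasSum (fun i => ⟪J (w i), J u⟫_ℝ ^ 2) (‖J u‖ ^ 2) := by
    have := b.hasSum_inner_mul_inner (J u) (J u)
    rw [real_inner_self_eq_norm_sq] at this
    simpa only [hb, sq, real_inner_comm (J u)] using this
  have hle : ev (n - 1) * ‖J u‖ ^ 2 ≤ B u u := by
    refine le_of_tendsto' (hsum.mul_left (ev (n - 1))).tendsto_sum_nat fun m => ?_
    refine le_trans (Finset.sum_le_sum fun i _ => ?_) (h.sum_le_form hsymm hpos u (Finset.range m))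
    rcases lt_or_ge i (n - 1) with hi | hi
    · simp [hzero i hi]
    · exact mul_le_mul_of_nonneg_right (hmono hi) (sq_nonneg _)
  have h3 : 0 < ‖J u‖ ^ 2 := by
    have : J u ≠ 0 := fun h0 => hx0 (hΦ x h0)
    positivity
  exact le_of_mul_le_mul_right (hle.trans (hc x)) h3

/-- A positive compact symmetric operator attains its norm as an eigenvalue. -/
theorem exists_eigenvector_norm [CompleteSpace X] [Nontrivial X] {T : X →L[ℝ] X}
    (hT : IsCompactOperator T) (hsymm : T.IsSymmetric) (hpos : ∀ f, 0 ≤ ⟪T f, f⟫_ℝ) :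
    ∃ f, ‖f‖ = 1 ∧ T f = ‖T‖ • f := by
  rcases eq_or_ne T 0 with rfl | hT0
  · obtain ⟨f, hf⟩ := exists_norm_eq X zero_le_one
    exact ⟨f, hf, by simp⟩
  -- Over `ℝ` the spectrum might be empty; here that would make the spectral radius zero, but for a
  -- self-adjoint operator it equals the norm.
  have hne : (spectrum ℝ T).Nonempty := by
    by_contra! he
    have := T.spectralRadius_eq_nnnorm hsymm.isSelfAdjoint
    rw [spectralRadius, he] at this
    simp only [mem_empty_iff_false, not_false_eq_true, iSup_neg, bot_eq_zero, iSup_const] at this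
    exact hT0 (nnnorm_eq_zero.mp (by exact_mod_cast this.symm))
  obtain ⟨μ, hμ, hμT⟩ := spectrum.exists_nnnorm_eq_spectralRadius_of_nonempty hne
  rw [T.spectralRadius_eq_nnnorm hsymm.isSelfAdjoint] at hμT
  have hμT' : ‖μ‖ = ‖T‖ := by simpa using congrArg ENNReal.toReal hμT
  have hμ0 : μ ≠ 0 := by
    rw [← norm_ne_zero_iff, hμT', norm_ne_zero_iff]; exact hT0
  -- A nonzero spectral value of a compact operator is an eigenvalue; positivity then excludes
  -- `-‖T‖`.
  obtain ⟨f, hf⟩ := ((hT.hasEigenvalue_iff_mem_spectrum hμ0).mpr hμ).exists_hasEigenvector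
  have hf0 : f ≠ 0 := hf.2
  have hfT : T f = μ • f := hf.apply_eq_smul
  have hμpos : 0 ≤ μ := by
    have := hpos f
    rw [hfT, real_inner_smul_left, real_inner_self_eq_norm_sq] at this
    have : 0 < ‖f‖ ^ 2 := by positivity
    by_contra! hneg
    nlinarith
  have : μ = ‖T‖ := by rw [← hμT', Real.norm_of_nonneg hμpos]
  refine ⟨‖f‖⁻¹ • f, norm_smul_inv_norm hf0, ?_⟩
  rw [map_smul, hfT, this, smul_comm]

/-- The maximum principle on the complement of an invariant finite-dimensional subspace. -/
theorem exists_eigenvector_max_orthogonal [CompleteSpace X] {T : X →L[ℝ] X}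
    (hT : IsCompactOperator T) (hsymm : T.IsSymmetric) (hpos : ∀ f, 0 ≤ ⟪T f, f⟫_ℝ)
    {F : Submodule ℝ X} (hF : ∀ f ∈ F, T f ∈ F) (hne : Fᗮ ≠ ⊥) :
    ∃ μ : ℝ, ∃ f ∈ Fᗮ, ‖f‖ = 1 ∧ T f = μ • f ∧ ∀ g ∈ Fᗮ, ⟪T g, g⟫_ℝ ≤ μ * ‖g‖ ^ 2 := by
  have hinv : ∀ f ∈ Fᗮ, T f ∈ Fᗮ := fun f hf g hg => by
    exact (hsymm g f).symm.trans (hf _ (hF g hg))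
  let S : Fᗮ →L[ℝ] Fᗮ := T.restrict hinv
  have : Nontrivial Fᗮ := Submodule.nontrivial_iff_ne_bot.mpr hne
  have hS : IsCompactOperator S := hT.restrict' hinv
  obtain ⟨f, hf, hSf⟩ := exists_eigenvector_norm hS (hsymm.restrict_invariant hinv)
    fun f => hpos f
  refine ⟨‖S‖, f, f.2, hf, congrArg Subtype.val hSf, fun g hg => ?_⟩
  have h1 : ⟪T g, g⟫_ℝ = ⟪S ⟨g, hg⟩, ⟨g, hg⟩⟫_ℝ := rfl
  have h2 := S.le_opNorm ⟨g, hg⟩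
  rw [h1]
  refine (real_inner_le_norm _ _).trans ?_
  rw [sq, ← mul_assoc]
  exact mul_le_mul_of_nonneg_right h2 (norm_nonneg g)

/-- An orthonormal sequence of eigenvectors of a positive compact symmetric operator, in the order
of decreasing eigenvalues, each of them maximal on the complement of the previous vectors. -/
theorem exists_eigenvector_seq [CompleteSpace X] {T : X →L[ℝ] X}
    (hT : IsCompactOperator T) (hsymm : T.IsSymmetric) (hpos : ∀ f, 0 ≤ ⟪T f, f⟫_ℝ)
    (hinf : ¬ FiniteDimensional ℝ X) :
    ∃ (μ : ℕ → ℝ) (b : ℕ → X), Orthonormal ℝ b ∧ (∀ n, T (b n) = μ n • b n) ∧ Antitone μ ∧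
      ∀ g, (∀ n, ⟪b n, g⟫_ℝ = 0) → ∀ n, ⟪T g, g⟫_ℝ ≤ μ n * ‖g‖ ^ 2 := by
  -- The state of the recursion is the span of the eigenvectors found so far, with the finite
  -- dimension and invariance that the next step needs.
  let S := {F : Submodule ℝ X // FiniteDimensional ℝ F ∧ ∀ f ∈ F, T f ∈ F}
  have hex : ∀ F : S, ∃ p : ℝ × X, p.2 ∈ F.1ᗮ ∧ ‖p.2‖ = 1 ∧ T p.2 = p.1 • p.2 ∧
      ∀ g ∈ F.1ᗮ, ⟪T g, g⟫_ℝ ≤ p.1 * ‖g‖ ^ 2 := by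
    rintro ⟨F, hF, hFT⟩
    obtain ⟨μ, f, hf⟩ := exists_eigenvector_max_orthogonal hT hsymm hpos hFT fun h => by
      rw [Submodule.orthogonal_eq_bot_iff] at h
      rw [h] at hF
      exact hinf (Module.finite_def.mpr (Module.Finite.iff_fg.mp hF))
    exact ⟨(μ, f), hf⟩
  choose p hp1 hp2 hp3 hp4 using hex
  let step : S → S := fun F => ⟨F.1 ⊔ Submodule.span ℝ {(p F).2}, by
    have := F.2.1
    refine ⟨inferInstance, fun f hf => ?_⟩
    obtain ⟨a, ha, b, hb, rfl⟩ := Submodule.mem_sup.mp hf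
    obtain ⟨c, rfl⟩ := Submodule.mem_span_singleton.mp hb
    rw [map_add, map_smul, hp3, smul_comm]
    exact Submodule.add_mem_sup (F.2.2 a ha)
      (Submodule.smul_mem _ _ (Submodule.smul_mem _ _ (Submodule.mem_span_singleton_self _)))⟩
  let F : ℕ → S := fun n => step^[n] ⟨⊥, inferInstance, by simp⟩
  have hsucc : ∀ n, (F (n + 1)).1 = (F n).1 ⊔ Submodule.span ℝ {(p (F n)).2} := fun n => by
    simp only [F, Function.iterate_succ_apply']
    rfl
  have hFmono : Monotone fun n => (F n).1 := monotone_nat_of_le_succ fun n => by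
    simp only [hsucc]; exact le_sup_left
  have hmem : ∀ n, (p (F n)).2 ∈ (F (n + 1)).1 := fun n => by
    rw [hsucc]; exact Submodule.mem_sup_right (Submodule.mem_span_singleton_self _)
  have horth : ∀ m n, m < n → ⟪(p (F m)).2, (p (F n)).2⟫_ℝ = 0 := fun m n hmn =>
    hp1 (F n) _ (hFmono (Nat.succ_le_of_lt hmn) (hmem m))
  refine ⟨fun n => (p (F n)).1, fun n => (p (F n)).2, ⟨fun n => hp2 _, fun m n hmn => ?_⟩,
    fun n => hp3 _, fun m n hmn => ?_, fun g hg n => hp4 _ g ?_⟩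
  · rcases lt_or_gt_of_ne hmn with h | h
    · exact horth m n h
    · rw [real_inner_comm]; exact horth n m h
  -- A later vector competes in the earlier maximum, since the complements decrease.
  · have := hp4 (F m) (p (F n)).2 (Submodule.orthogonal_le (hFmono hmn) (hp1 (F n)))
    rw [hp3, real_inner_smul_left, real_inner_self_eq_norm_sq, hp2] at this
    simpa using this
  · have key : ∀ n, (F n).1 ≤ (Submodule.span ℝ {g})ᗮ := fun n => by
      induction n with
      | zero => exact bot_le
      | succ n ih =>
        rw [hsucc]
        refine sup_le ih ((Submodule.span_singleton_le_iff_mem _ _).mpr ?_)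
        rw [Submodule.mem_orthogonal_singleton_iff_inner_left]
        exact hg n
    intro f hf
    exact Submodule.mem_orthogonal_singleton_iff_inner_left.mp (key n hf)

/-- A bounded map whose restrictions to subspaces of finite codimension have arbitrarily small norm
is compact. -/
theorem isCompactOperator_of_small_on_ker [CompleteSpace W] [CompleteSpace X]
    (hsmall : ∀ ε > 0, ∃ m : ℕ, ∃ P : W →L[ℝ] (Fin m → ℝ), ∀ u, P u = 0 → ‖J u‖ ≤ ε * ‖u‖) :
    IsCompactOperator J := by
  refine isClosed_setOfPred_isCompactOperator.closure_subset
    (Metric.mem_closure_iff.mpr fun ε hε => ?_)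
  obtain ⟨m, P, hP⟩ := hsmall (ε / 2) (by positivity)
  have : CompleteSpace P.ker := (ContinuousLinearMap.isClosed_ker P).completeSpace_coe
  -- `P` is injective on `Kᗮ`, so composing `J` with the projection onto `Kᗮ` gives a finite rank
  -- operator; the error is `J` on the `K` component, where it is small.
  let K : Submodule ℝ W := P.ker
  have hfin : FiniteDimensional ℝ Kᗮ := by
    refine Module.Finite.of_injective (P.toLinearMap ∘ₗ Kᗮ.subtype) ?_
    rw [← LinearMap.ker_eq_bot, Submodule.eq_bot_iff]
    rintro ⟨u, hu⟩ hu0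
    have : u ∈ K := hu0
    have := hu u this
    simpa using this
  refine ⟨(J ∘L Kᗮ.subtypeL) ∘L Kᗮ.orthogonalProjectionOnto, ?_, ?_⟩
  · exact (isCompactOperator_of_locallyCompactSpace_rng (J ∘L Kᗮ.subtypeL)).comp_clm _
  · rw [dist_eq_norm]
    refine lt_of_le_of_lt (ContinuousLinearMap.opNorm_le_bound _ (by positivity) fun u => ?_)
      (half_lt_self hε)
    have h1 : J u - J (Kᗮ.orthogonalProjectionOnto u) = J (K.orthogonalProjectionOnto u) := by
      rw [← map_sub]
      congr 1
      have := K.starProjection_add_starProjection_orthogonal u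
      simp only [Submodule.starProjection_apply] at this
      exact sub_eq_of_eq_add this.symm
    calc _ = ‖J (K.orthogonalProjectionOnto u)‖ := by rw [← h1]; rfl
      _ ≤ ε / 2 * ‖(K.orthogonalProjectionOnto u : W)‖ := hP _ (K.orthogonalProjectionOnto u).2
      _ ≤ ε / 2 * ‖u‖ := by
        gcongr
        exact K.norm_orthogonalProjectionOnto_apply_le u

/-- A symmetric coercive form, bounded below on spaces of finite codimension by a multiple of the
squared norm that tends to infinity, has a complete system of eigenvectors. -/
theorem exists_isFormEigensystem [CompleteSpace W] [CompleteSpace X]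
    (hsymm : ∀ u v, B u v = B v u) (hB : IsCoercive B)
    (hdense : ∀ f, (∀ v, ⟪f, J v⟫_ℝ = 0) → f = 0) {c : ℝ} (hc : 0 < c)
    (hlow : ∀ n : ℕ, 1 ≤ n → ∃ m < n, ∃ P : W →L[ℝ] (Fin m → ℝ),
      ∀ u, P u = 0 → c * (n : ℝ) ^ 2 * ‖J u‖ ^ 2 ≤ B u u)
    (hinf : ¬ FiniteDimensional ℝ X) :
    ∃ (ev : ℕ → ℝ) (w : ℕ → W), IsFormEigensystem J B ev w ∧ Monotone ev ∧
      (Submodule.span ℝ (range fun n => J (w n))).topologicalClosure = ⊤ := by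
  have hBpos : ∀ u, 0 ≤ B u u := fun u => by
    obtain ⟨C, hC, h⟩ := hB
    exact le_trans (by positivity) (h u)
  have hBpos' : ∀ u, u ≠ 0 → 0 < B u u := fun u hu => by
    obtain ⟨C, hC, h⟩ := hB
    exact lt_of_lt_of_le (by positivity) (h u)
  have hJ : IsCompactOperator J := isCompactOperator_of_small_on_ker fun ε hε => by
    obtain ⟨n, hn⟩ := exists_nat_ge (max 1 (‖B‖ / (c * ε ^ 2)))
    have hn1 : (1 : ℝ) ≤ n := (le_max_left _ _).trans hn
    obtain ⟨m, -, P, hP⟩ := hlow n (by exact_mod_cast hn1)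
    refine ⟨m, P, fun u hu => ?_⟩
    have h1 := hP u hu
    have h2 : B u u ≤ ‖B‖ * ‖u‖ * ‖u‖ := (le_abs_self _).trans (B.le_opNorm₂ u u)
    have h3 : ‖B‖ ≤ c * ε ^ 2 * n ^ 2 := by
      have := (le_max_right _ _).trans hn
      rw [div_le_iff₀ (by positivity)] at this
      have : ‖B‖ ≤ (c * ε ^ 2) * (n : ℝ) := by linarith
      refine this.trans ?_
      gcongr
      nlinarith
    have h4 : (c * (n : ℝ) ^ 2) * ‖J u‖ ^ 2 ≤ (c * (n : ℝ) ^ 2) * (ε * ‖u‖) ^ 2 := by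
      refine (h1.trans h2).trans ?_
      calc ‖B‖ * ‖u‖ * ‖u‖ ≤ (c * ε ^ 2 * n ^ 2) * ‖u‖ * ‖u‖ := by gcongr
        _ = _ := by ring
    exact (sq_le_sq₀ (by positivity) (by positivity)).mp
      (le_of_mul_le_mul_left h4 (by positivity))
  -- The Lax-Milgram solution operator: `S f` solves the weak equation with right-hand side `f`.
  let S : X →L[ℝ] W := (hB.continuousLinearEquivOfBilin.symm : W →L[ℝ] W) ∘L J.adjoint
  have hS : ∀ f v, B (S f) v = ⟪f, J v⟫_ℝ := fun f v => by
    rw [← hB.continuousLinearEquivOfBilin_apply, ← ContinuousLinearMap.adjoint_inner_left]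
    simp [S]
  have hTsymm : (J ∘L S).IsSymmetric := fun f g => by
    change ⟪J (S f), g⟫_ℝ = ⟪f, J (S g)⟫_ℝ
    rw [real_inner_comm, ← hS, ← hS, hsymm]
  have hTf : ∀ f, ⟪(J ∘L S) f, f⟫_ℝ = B (S f) (S f) := fun f => by
    rw [hS, real_inner_comm]; rfl
  obtain ⟨μ, b, hb, hTb, hμ, hmax⟩ := exists_eigenvector_seq (T := J ∘L S) (hJ.comp_clm S) hTsymm
    (fun f => by rw [hTf]; exact hBpos _) hinf
  -- Density of the range of `J` makes `S` injective, so no eigenvalue of `J ∘L S` vanishes and each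
  -- can be inverted.
  have hS0 : ∀ f, f ≠ 0 → S f ≠ 0 := fun f hf h0 => hf (hdense f fun v => by
    rw [← hS, h0]; simp)
  have hμpos : ∀ n, 0 < μ n := fun n => by
    have h1 := hTf (b n)
    rw [hTb, real_inner_smul_left, real_inner_self_eq_norm_sq, hb.1 n] at h1
    have := hBpos' _ (hS0 (b n) (hb.ne_zero n))
    linarith
  let w : ℕ → W := fun n => (μ n)⁻¹ • S (b n)
  have hJw : ∀ n, J (w n) = b n := fun n => by
    have : J (S (b n)) = μ n • b n := hTb n
    simp only [w, map_smul, this, smul_smul, inv_mul_cancel₀ (hμpos n).ne', one_smul]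
  have hsys : IsFormEigensystem J B (fun n => (μ n)⁻¹) w := by
    refine ⟨by simpa only [hJw] using hb, fun n v => ?_⟩
    rw [hJw, ← hS]; simp [w]
  have hmono : Monotone fun n => (μ n)⁻¹ := fun m n hmn => by
    have := hμ hmn
    have := hμpos n
    simp only
    gcongr
  refine ⟨_, w, hsys, hmono, ?_⟩
  rw [Submodule.topologicalClosure_eq_top_iff, Submodule.eq_bot_iff]
  intro g hg
  simp only [hJw] at hg
  have hg' : ∀ n, ⟪b n, g⟫_ℝ = 0 := fun n => hg _ (Submodule.subset_span ⟨n, rfl⟩)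
  by_contra hg0
  have hpos : 0 < B (S g) (S g) := hBpos' _ (hS0 g hg0)
  -- Orthogonality to all `b n` gives `B (S g) (S g) ≤ μ (n - 1) * ‖g‖ ^ 2`, while the codimension
  -- bound gives `μ (n - 1) ≤ 1 / (c n²)`. This `n` makes the two incompatible.
  obtain ⟨n, hn⟩ := exists_nat_ge (max 1 (‖g‖ ^ 2 / (c * B (S g) (S g)) + 1))
  have hn1 : (1 : ℝ) ≤ n := (le_max_left _ _).trans hn
  have hn2 := (le_max_right _ _).trans hn
  obtain ⟨m, hm, P, hP⟩ := hlow n (by exact_mod_cast hn1)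
  have h1 : c * (n : ℝ) ^ 2 ≤ (μ (n - 1))⁻¹ :=
    hsys.le_ev hmono P.toLinearMap (by simpa using hm) hP
  have h2 := hmax g hg' (n - 1)
  rw [hTf] at h2
  have h3 : μ (n - 1) * (c * (n : ℝ) ^ 2) ≤ 1 := by
    have := mul_le_mul_of_nonneg_left h1 (hμpos (n - 1)).le
    rwa [mul_inv_cancel₀ (hμpos _).ne'] at this
  have h4 : ‖g‖ ^ 2 < n * (c * B (S g) (S g)) := by
    rw [← div_lt_iff₀ (by positivity)]; linarith
  have h5 : (n : ℝ) * (c * B (S g) (S g)) ≤ (n : ℝ) ^ 2 * (c * B (S g) (S g)) := by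
    gcongr
    nlinarith
  have h6 : B (S g) (S g) * (c * (n : ℝ) ^ 2) ≤ μ (n - 1) * ‖g‖ ^ 2 * (c * (n : ℝ) ^ 2) :=
    mul_le_mul_of_nonneg_right h2 (by positivity)
  nlinarith [sq_nonneg ‖g‖]

end FormEigenvalues

/-! ### Primitives of square integrable functions on one edge. -/

section Edge

variable {l : ℝ} {f g f₁ g₁ f₂ g₂ : ℝ → ℝ}

theorem integral_edgeMeasure (hl : 0 ≤ l) (f : ℝ → ℝ) :
    ∫ x, f x ∂edgeMeasure l = ∫ x in 0..l, f x := by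
  rw [intervalIntegral.integral_of_le hl, integral_Icc_eq_integral_Ioc]

theorem Integrable.intervalIntegrable_edge (h : Integrable f (edgeMeasure l)) {a b : ℝ}
    (ha : a ∈ Icc 0 l) (hb : b ∈ Icc 0 l) : IntervalIntegrable f volume a b :=
  IntegrableOn.intervalIntegrable
    (IntegrableOn.mono_set (h : IntegrableOn f (Icc 0 l) volume) (uIcc_subset_Icc ha hb))

theorem MemLp.intervalIntegrable_edge (h : MemLp f 2 (edgeMeasure l)) {a b : ℝ}
    (ha : a ∈ Icc 0 l) (hb : b ∈ Icc 0 l) : IntervalIntegrable f volume a b :=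
  Integrable.intervalIntegrable_edge (h.integrable one_le_two) ha hb

theorem ContinuousOn.memLp_edge (h : ContinuousOn f (Icc 0 l)) (p : ENNReal) :
    MemLp f p (edgeMeasure l) := by
  obtain ⟨C, hC⟩ := isCompact_Icc.exists_bound_of_continuousOn h
  refine MemLp.of_bound (h.aestronglyMeasurable measurableSet_Icc) C ?_
  exact (ae_restrict_iff' measurableSet_Icc).mpr (Filter.Eventually.of_forall hC)

theorem MemLp.mul_continuousOn_edge (hg : MemLp g 2 (edgeMeasure l))
    (hf : ContinuousOn f (Icc 0 l)) : MemLp (fun x => g x * f x) 2 (edgeMeasure l) :=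
  MemLp.mul (hf.memLp_edge ⊤) hg

/-- The Cauchy-Schwarz inequality on an interval. -/
theorem sq_intervalIntegral_le {a b : ℝ} (hab : a ≤ b) (hg : IntervalIntegrable g volume a b)
    (hg2 : IntervalIntegrable (fun x => g x ^ 2) volume a b) :
    (∫ x in a..b, g x) ^ 2 ≤ (b - a) * ∫ x in a..b, g x ^ 2 := by
  rcases hab.eq_or_lt with rfl | hab'
  · simp
  have hba : 0 < b - a := sub_pos.mpr hab'
  set I := ∫ x in a..b, g x with hI
  -- `m` is the mean of `g`; the inequality says that the variance is nonnegative.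
  set m := I / (b - a) with hm
  have h1 : 0 ≤ ∫ x in a..b, (g x - m) ^ 2 :=
    intervalIntegral.integral_nonneg hab fun x _ => sq_nonneg _
  have h2 : ∫ x in a..b, (g x - m) ^ 2 = (∫ x in a..b, g x ^ 2) - 2 * m * I + (b - a) * m ^ 2 := by
    have : ∀ x, (g x - m) ^ 2 = g x ^ 2 - 2 * m * g x + m ^ 2 := fun x => by ring
    simp_rw [this]
    rw [intervalIntegral.integral_add (hg2.sub (hg.const_mul _)) (by simp),
      intervalIntegral.integral_sub hg2 (hg.const_mul _), intervalIntegral.integral_const_mul,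
      intervalIntegral.integral_const, smul_eq_mul]
  rw [h2] at h1
  have h3 : I = m * (b - a) := by rw [hm]; field_simp
  rw [h3] at h1 ⊢
  nlinarith

/-- `f` is on `[0, l]` a primitive of the square integrable function `g`. -/
structure IsPrimitive (l : ℝ) (f g : ℝ → ℝ) : Prop where
  memLp : MemLp g 2 (edgeMeasure l)
  eq_add : ∀ x ∈ Icc 0 l, f x = f 0 + ∫ t in 0..x, g t

namespace IsPrimitive

theorem of_integral (hg : MemLp g 2 (edgeMeasure l)) (c : ℝ) :
    IsPrimitive l (fun x => c + ∫ t in 0..x, g t) g :=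
  ⟨hg, fun x _ => by simp⟩

theorem intervalIntegrable (h : IsPrimitive l f g) {a b : ℝ} (ha : a ∈ Icc 0 l)
    (hb : b ∈ Icc 0 l) : IntervalIntegrable g volume a b :=
  MemLp.intervalIntegrable_edge h.memLp ha hb

theorem intervalIntegrable_sq (h : IsPrimitive l f g) {a b : ℝ} (ha : a ∈ Icc 0 l)
    (hb : b ∈ Icc 0 l) : IntervalIntegrable (fun x => g x ^ 2) volume a b :=
  Integrable.intervalIntegrable_edge h.memLp.integrable_sq ha hb

theorem sub_eq (h : IsPrimitive l f g) {a b : ℝ} (ha : a ∈ Icc 0 l) (hb : b ∈ Icc 0 l) :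
    f b - f a = ∫ t in a..b, g t := by
  have h0 : (0 : ℝ) ∈ Icc 0 l := ⟨le_rfl, ha.1.trans ha.2⟩
  rw [h.eq_add a ha, h.eq_add b hb, ← intervalIntegral.integral_add_adjacent_intervals
    (h.intervalIntegrable h0 ha) (h.intervalIntegrable ha hb)]
  ring

/-- Stated for the integral formula because `f` is controlled only on `[0, l]`. -/
theorem absolutelyContinuous (h : IsPrimitive l f g) {b : ℝ} (hb : b ∈ Icc 0 l) :
    AbsolutelyContinuousOnInterval (fun x => f 0 + ∫ t in 0..x, g t) 0 b := by
  have h0 : (0 : ℝ) ∈ Icc 0 l := ⟨le_rfl, hb.1.trans hb.2⟩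
  have hc : AbsolutelyContinuousOnInterval (fun _ : ℝ => f 0) 0 b :=
    (LipschitzWith.const (f 0)).lipschitzOnWith.absolutelyContinuousOnInterval
  exact hc.add ((h.intervalIntegrable h0 hb).absolutelyContinuousOnInterval_intervalIntegral
    left_mem_uIcc)

theorem continuousOn (h : IsPrimitive l f g) : ContinuousOn f (Icc 0 l) := by
  rcases lt_or_ge l 0 with hl | hl
  · simp [Icc_eq_empty_of_lt hl]
  have := (h.absolutelyContinuous (right_mem_Icc.mpr hl)).continuousOn
  rw [uIcc_of_le hl] at this
  exact this.congr fun x hx => h.eq_add x hx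

/-- Integration by parts. -/
theorem integral_deriv_mul (h₁ : IsPrimitive l f₁ g₁) (h₂ : IsPrimitive l f₂ g₂) {b : ℝ}
    (hb : b ∈ Icc 0 l) :
    ∫ x in 0..b, (g₁ x * f₂ x + f₁ x * g₂ x) = f₁ b * f₂ b - f₁ 0 * f₂ 0 := by
  have h0 : (0 : ℝ) ∈ Icc 0 l := ⟨le_rfl, hb.1.trans hb.2⟩
  have key := (h₁.absolutelyContinuous hb).integral_deriv_mul_eq_sub (h₂.absolutelyContinuous hb)
  simp only [intervalIntegral.integral_same, add_zero] at key
  rw [← h₁.eq_add b hb, ← h₂.eq_add b hb] at key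
  rw [← key]
  apply intervalIntegral.integral_congr_ae
  filter_upwards [(h₁.intervalIntegrable h0 hb).ae_hasDerivAt_integral,
    (h₂.intervalIntegrable h0 hb).ae_hasDerivAt_integral] with x hx₁ hx₂ hx
  have hx' : x ∈ uIcc 0 b := uIoc_subset_uIcc hx
  have hxl : x ∈ Icc 0 l := by
    rw [uIcc_of_le hb.1] at hx'; exact ⟨hx'.1, hx'.2.trans hb.2⟩
  rw [((hx₁ hx' 0 left_mem_uIcc).const_add _).deriv, ((hx₂ hx' 0 left_mem_uIcc).const_add _).deriv,
    ← h₁.eq_add x hxl, ← h₂.eq_add x hxl]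

theorem mul (h₁ : IsPrimitive l f₁ g₁) (h₂ : IsPrimitive l f₂ g₂) :
    IsPrimitive l (fun x => f₁ x * f₂ x) fun x => g₁ x * f₂ x + f₁ x * g₂ x := by
  refine ⟨(MemLp.mul_continuousOn_edge h₁.memLp h₂.continuousOn).add ?_, fun x hx => ?_⟩
  · simpa only [mul_comm] using MemLp.mul_continuousOn_edge h₂.memLp h₁.continuousOn
  · rw [h₁.integral_deriv_mul h₂ hx]; ring

theorem congr_right (h : IsPrimitive l f g) {g' : ℝ → ℝ} (hg : g =ᵐ[edgeMeasure l] g') :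
    IsPrimitive l f g' := by
  refine ⟨(memLp_congr_ae hg).mp h.memLp, fun x hx => ?_⟩
  rw [h.eq_add x hx]
  congr 1
  apply intervalIntegral.integral_congr_ae
  filter_upwards [(ae_restrict_iff' measurableSet_Icc).mp hg] with t ht htx
  rw [uIoc_of_le hx.1] at htx
  exact ht ⟨htx.1.le, htx.2.trans hx.2⟩

theorem of_hasDerivAt (hf : ∀ x, HasDerivAt f (g x) x) (hg : Continuous g) : IsPrimitive l f g :=
  ⟨hg.continuousOn.memLp_edge 2, fun x _ => by
    rw [intervalIntegral.integral_eq_sub_of_hasDerivAt (fun t _ => hf t)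
      (hg.intervalIntegrable _ _)]; ring⟩

/-- A Lipschitz function is absolutely continuous, hence the integral of its derivative, which is
bounded by `K`. This is applied to the reciprocal of `H`. -/
theorem of_lipschitzOn {K : NNReal} (hf : LipschitzOnWith K f (Icc 0 l)) :
    IsPrimitive l f (deriv f) := by
  refine ⟨MemLp.of_bound (measurable_deriv f).aestronglyMeasurable K ?_, fun x hx => ?_⟩
  -- At the ends `deriv f` depends on values outside the interval, so they are discarded as a null
  -- set.
  · rw [edgeMeasure, ← restrict_Ioo_eq_restrict_Icc, ae_restrict_iff' measurableSet_Ioo]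
    exact Filter.Eventually.of_forall fun x hx =>
      norm_deriv_le_of_lipschitzOn (Icc_mem_nhds hx.1 hx.2) hf
  · have : LipschitzOnWith K f (uIcc 0 x) := hf.mono (by
      rw [uIcc_of_le hx.1]; exact Icc_subset_Icc_right hx.2)
    rw [this.absolutelyContinuousOnInterval.integral_deriv_eq_sub]
    ring

theorem hasSobolevDeriv (h : IsPrimitive l f g) (hl : 0 ≤ l) : HasSobolevDeriv l f g := by
  refine ⟨h.continuousOn.memLp_edge 2, h.memLp, fun φ hφ hφc hφs => ?_⟩
  have hd : IsPrimitive l φ (deriv φ) := of_hasDerivAt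
    (fun x => (hφ.differentiable (by simp)).differentiableAt.hasDerivAt)
    (hφ.continuous_deriv (by simp))
  have h0 : φ 0 = 0 := image_eq_zero_of_notMem_tsupport fun h => (hφs h).1.false
  have h1 : φ l = 0 := image_eq_zero_of_notMem_tsupport fun h => (hφs h).2.false
  have key := h.integral_deriv_mul hd (right_mem_Icc.mpr hl)
  have hl' := right_mem_Icc.mpr hl
  have hl0 := left_mem_Icc.mpr hl
  have i1 : IntervalIntegrable (fun x => g x * φ x) volume 0 l :=
    MemLp.intervalIntegrable_edge (MemLp.mul_continuousOn_edge h.memLp hd.continuousOn) hl0 hl'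
  have i2 : IntervalIntegrable (fun x => deriv φ x * f x) volume 0 l :=
    MemLp.intervalIntegrable_edge (MemLp.mul_continuousOn_edge hd.memLp h.continuousOn) hl0 hl'
  simp only [mul_comm (deriv φ _)] at i2
  rw [intervalIntegral.integral_add i1 i2, h0, h1] at key
  rw [integral_edgeMeasure hl, integral_edgeMeasure hl]
  linarith

theorem sq_sub_le (h : IsPrimitive l f g) {a b : ℝ} (ha : a ∈ Icc 0 l) (hb : b ∈ Icc 0 l)
    (hab : a ≤ b) : (f b - f a) ^ 2 ≤ (b - a) * ∫ x in a..b, g x ^ 2 := by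
  rw [h.sub_eq ha hb]
  exact sq_intervalIntegral_le hab (h.intervalIntegrable ha hb) (h.intervalIntegrable_sq ha hb)

theorem integral_sq_mono (h : IsPrimitive l f g) {a b : ℝ} (ha : a ∈ Icc 0 l) (hb : b ∈ Icc 0 l)
    (hab : a ≤ b) : ∫ x in a..b, g x ^ 2 ≤ ∫ x in 0..l, g x ^ 2 := by
  have hl : 0 ≤ l := ha.1.trans ha.2
  refine intervalIntegral.integral_mono_interval ha.1 hab hb.2
    (Filter.Eventually.of_forall fun x => sq_nonneg (g x))
    (h.intervalIntegrable_sq (left_mem_Icc.mpr hl) (right_mem_Icc.mpr hl))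

/-- The trace inequality. -/
theorem sq_add_sq_le (h : IsPrimitive l f g) (hl : 0 < l) {δ : ℝ} (hδ : 0 < δ) :
    f 0 ^ 2 + f l ^ 2 ≤
      2 * (1 + δ) / l * (∫ x in 0..l, f x ^ 2) + (1 + δ⁻¹) * l * ∫ x in 0..l, g x ^ 2 := by
  set G := ∫ x in 0..l, g x ^ 2 with hG
  have h0 := left_mem_Icc.mpr hl.le
  have h1 := right_mem_Icc.mpr hl.le
  -- Young's inequality for `a = b - (b - a)`, with the weight `δ` kept free.
  have young : ∀ a b : ℝ, a ^ 2 ≤ (1 + δ) * b ^ 2 + (1 + δ⁻¹) * (b - a) ^ 2 := fun a b => by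
    have : (1 + δ) * b ^ 2 + (1 + δ⁻¹) * (b - a) ^ 2 - a ^ 2 = δ⁻¹ * (δ * b + (b - a)) ^ 2 := by
      field_simp; ring
    have : 0 ≤ δ⁻¹ * (δ * b + (b - a)) ^ 2 := by positivity
    linarith
  -- Both end values are compared with the same `f x`. The errors `x * G` and `(l - x) * G` add up
  -- to `l * G` rather than `2 * l * G`; the edge length condition relies on this constant.
  have hpt : ∀ x ∈ Icc 0 l, f 0 ^ 2 + f l ^ 2 ≤ 2 * (1 + δ) * f x ^ 2 + (1 + δ⁻¹) * l * G := by
    intro x hx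
    have a1 : (f x - f 0) ^ 2 ≤ x * G := by
      refine (h.sq_sub_le h0 hx hx.1).trans ?_
      rw [sub_zero]
      exact mul_le_mul_of_nonneg_left (h.integral_sq_mono h0 hx hx.1) hx.1
    have a2 : (f x - f l) ^ 2 ≤ (l - x) * G := by
      rw [← neg_sq, neg_sub]
      exact (h.sq_sub_le hx h1 hx.2).trans
        (mul_le_mul_of_nonneg_left (h.integral_sq_mono hx h1 hx.2) (sub_nonneg.mpr hx.2))
    have hδ' : 0 < 1 + δ⁻¹ := by positivity
    have b1 := mul_le_mul_of_nonneg_left a1 hδ'.le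
    have b2 := mul_le_mul_of_nonneg_left a2 hδ'.le
    have := young (f 0) (f x)
    have := young (f l) (f x)
    linarith
  have hf2 : IntervalIntegrable (fun x => f x ^ 2) volume 0 l :=
    ((h.continuousOn.pow 2).mono (by rw [uIcc_of_le hl.le])).intervalIntegrable
  have hint := intervalIntegral.integral_mono_on hl.le (intervalIntegrable_const)
    ((hf2.const_mul (2 * (1 + δ))).add intervalIntegrable_const) hpt
  rw [intervalIntegral.integral_add (hf2.const_mul _) intervalIntegrable_const,
    intervalIntegral.integral_const_mul, intervalIntegral.integral_const,
    intervalIntegral.integral_const, smul_eq_mul, smul_eq_mul, sub_zero] at hint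
  rw [div_mul_eq_mul_div, ← sub_le_iff_le_add, le_div_iff₀ hl]
  linarith

/-- A function that vanishes at one end of each of `N` equal cells is controlled by its derivative.
-/
theorem integral_sq_le_of_nodes (h : IsPrimitive l f g) (hl : 0 < l) {N : ℕ} (hN : 0 < N)
    (hnode : ∀ j < N, f (j * (l / N)) = 0) :
    ∫ x in 0..l, f x ^ 2 ≤ (l / N) ^ 2 * ∫ x in 0..l, g x ^ 2 := by
  set k := l / N with hk
  have hNpos : (0 : ℝ) < N := by exact_mod_cast hN
  have hkpos : 0 < k := by positivity
  have hNk : N * k = l := by rw [hk]; field_simp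
  have hnodes : ∀ j ≤ N, (j : ℝ) * k ∈ Icc 0 l := fun j hj => by
    refine ⟨by positivity, ?_⟩
    rw [← hNk]
    have : (j : ℝ) ≤ N := by exact_mod_cast hj
    gcongr
  have hf2 : ∀ a ∈ Icc 0 l, ∀ b ∈ Icc 0 l, IntervalIntegrable (fun x => f x ^ 2) volume a b :=
    fun a ha b hb => ((h.continuousOn.pow 2).mono (uIcc_subset_Icc ha hb)).intervalIntegrable
  have e1 := intervalIntegral.sum_integral_adjacent_intervals (f := fun x => f x ^ 2)
    (μ := volume) (a := fun j : ℕ => (j : ℝ) * k) (n := N)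
    (fun j hj => hf2 _ (hnodes j hj.le) _ (hnodes (j + 1) hj))
  have e2 := intervalIntegral.sum_integral_adjacent_intervals (f := fun x => g x ^ 2)
    (μ := volume) (a := fun j : ℕ => (j : ℝ) * k) (n := N)
    (fun j hj => h.intervalIntegrable_sq (hnodes j hj.le) (hnodes (j + 1) hj))
  simp only [Nat.cast_zero, zero_mul, hNk] at e1 e2
  rw [← e1, ← e2, Finset.mul_sum]
  refine Finset.sum_le_sum fun j hj => ?_
  have hj := Finset.mem_range.mp hj
  have ha := hnodes j hj.le
  have hb := hnodes (j + 1) hj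
  set a := (j : ℝ) * k with ha'
  set b := ((j + 1 : ℕ) : ℝ) * k with hb'
  have hba : b - a = k := by rw [hb', ha']; push_cast; ring
  have hab : a ≤ b := by linarith
  -- Cauchy-Schwarz from the zero at the left end of the cell gives one factor `k`; integration over
  -- the cell gives the other.
  have hpt : ∀ x ∈ Icc a b, f x ^ 2 ≤ k * ∫ x in a..b, g x ^ 2 := fun x hx => by
    have hxl : x ∈ Icc 0 l := ⟨ha.1.trans hx.1, hx.2.trans hb.2⟩
    have h1 := h.sq_sub_le ha hxl hx.1
    rw [hnode j hj, sub_zero] at h1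
    refine h1.trans (mul_le_mul (by linarith [hx.2]) ?_
      (intervalIntegral.integral_nonneg hx.1 fun _ _ => sq_nonneg _) hkpos.le)
    exact intervalIntegral.integral_mono_interval le_rfl hx.1 hx.2
      (Filter.Eventually.of_forall fun x => sq_nonneg (g x)) (h.intervalIntegrable_sq ha hb)
  have := intervalIntegral.integral_mono_on hab (hf2 a ha b hb)
    (intervalIntegrable_const) hpt
  rw [intervalIntegral.integral_const, hba, smul_eq_mul] at this
  linarith

end IsPrimitive

/-! ### Test functions and weak derivatives. -/

theorem exists_test_integral_eq_one (hl : 0 < l) :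
    ∃ φ : ℝ → ℝ, ContDiff ℝ ∞ φ ∧ HasCompactSupport φ ∧ tsupport φ ⊆ Ioo 0 l ∧
      ∫ x, φ x ∂edgeMeasure l = 1 := by
  let b : ContDiffBump (l / 2) := ⟨l / 8, l / 4, by positivity, by linarith⟩
  have hs : tsupport (b.normed volume) ⊆ Ioo 0 l := by
    rw [b.tsupport_normed_eq, Real.closedBall_eq_Icc]
    refine Icc_subset_Ioo ?_ ?_ <;> simp only [b] <;> linarith
  refine ⟨b.normed volume, b.contDiff_normed, b.hasCompactSupport_normed, hs, ?_⟩
  rw [edgeMeasure, setIntegral_eq_integral_of_forall_compl_eq_zero fun x hx => ?_, b.integral_normed]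
  exact image_eq_zero_of_notMem_tsupport fun h => hx (Ioo_subset_Icc_self (hs h))

/-- A test function with vanishing integral is the derivative of a test function. -/
theorem exists_test_deriv_eq (hl : 0 < l) {χ : ℝ → ℝ} (hχ : ContDiff ℝ ∞ χ)
    (hχc : HasCompactSupport χ) (hχs : tsupport χ ⊆ Ioo 0 l) (hχi : ∫ x in 0..l, χ x = 0) :
    ∃ ψ : ℝ → ℝ, ContDiff ℝ ∞ ψ ∧ HasCompactSupport ψ ∧ tsupport ψ ⊆ Ioo 0 l ∧ deriv ψ = χ := by
  have hcont := hχ.continuous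
  obtain ⟨a, b, ha, hb, hab⟩ : ∃ a b, 0 < a ∧ b < l ∧ tsupport χ ⊆ Icc a b := by
    rcases (tsupport χ).eq_empty_or_nonempty with he | hne
    -- For empty support the reversed ends make `Icc l 0` empty, so the bounds stay strict.
    · exact ⟨l, 0, hl, hl, by simp [he]⟩
    · obtain ⟨a, ha, ha'⟩ := hχc.isCompact.exists_isLeast hne
      obtain ⟨b, hb, hb'⟩ := hχc.isCompact.exists_isGreatest hne
      exact ⟨a, b, (hχs ha).1, (hχs hb).2, fun x hx => ⟨ha' hx, hb' hx⟩⟩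
  have hzero : ∀ x, x ∉ Icc a b → χ x = 0 := fun x hx =>
    image_eq_zero_of_notMem_tsupport fun h => hx (hab h)
  let ψ : ℝ → ℝ := fun x => ∫ t in 0..x, χ t
  have hd : ∀ x, HasDerivAt ψ (χ x) x := fun x =>
    intervalIntegral.integral_hasDerivAt_right (hcont.intervalIntegrable _ _)
      (hcont.stronglyMeasurableAtFilter _ _) hcont.continuousAt
  have hderiv : deriv ψ = χ := funext fun x => (hd x).deriv
  have hψ0 : ∀ x, x ∉ Icc a b → ψ x = 0 := fun x hx => by
    rw [mem_Icc, not_and_or, not_le, not_le] at hx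
    rcases hx with hx | hx
    · refine intervalIntegral.integral_zero_ae (Filter.Eventually.of_forall fun t ht => hzero t ?_)
      intro h
      have := ht.2.trans_lt (max_lt ha hx)
      exact absurd h.1 (not_le.mpr this)
    -- To the right of the support, `ψ` vanishes because the total integral does.
    · have : ψ x = (∫ t in 0..l, χ t) + ∫ t in l..x, χ t :=
        (intervalIntegral.integral_add_adjacent_intervals (hcont.intervalIntegrable _ _)
          (hcont.intervalIntegrable _ _)).symm
      rw [this, hχi, zero_add]
      refine intervalIntegral.integral_zero_ae (Filter.Eventually.of_forall fun t ht => hzero t ?_)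
      intro h
      have := (lt_min hb hx).trans ht.1
      exact absurd h.2 (not_le.mpr this)
  refine ⟨ψ, ?_, HasCompactSupport.intro isCompact_Icc hψ0, ?_, hderiv⟩
  · rw [contDiff_infty_iff_deriv]
    exact ⟨fun x => (hd x).differentiableAt, hderiv ▸ hχ⟩
  · refine (closure_minimal (fun x hx => ?_) isClosed_Icc).trans (Icc_subset_Ioo ha hb)
    by_contra h
    exact hx (hψ0 x h)

/-- A square integrable function that is orthogonal to the derivatives of all test functions is
constant. -/
theorem exists_ae_eq_const_of_integral_mul_deriv (hl : 0 < l) (hf : MemLp f 2 (edgeMeasure l))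
    (h : ∀ φ : ℝ → ℝ, ContDiff ℝ ∞ φ → HasCompactSupport φ → tsupport φ ⊆ Ioo 0 l →
      ∫ x, f x * deriv φ x ∂edgeMeasure l = 0) :
    ∃ c, ∀ᵐ x ∂edgeMeasure l, f x = c := by
  obtain ⟨φ₀, hφ₀, hφ₀c, hφ₀s, hφ₀i⟩ := exists_test_integral_eq_one hl
  set c := ∫ x, f x * φ₀ x ∂edgeMeasure l with hc
  have hfint : ∀ {φ : ℝ → ℝ}, Continuous φ → Integrable (fun x => f x * φ x) (edgeMeasure l) :=
    fun hφ => (MemLp.mul_continuousOn_edge hf hφ.continuousOn).integrable one_le_two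
  have hint : ∀ {φ : ℝ → ℝ}, Continuous φ → Integrable φ (edgeMeasure l) :=
    fun hφ => (hφ.continuousOn.memLp_edge 1).integrable le_rfl
  refine ⟨c, ?_⟩
  have key := isOpen_Ioo.ae_eq_zero_of_integral_contDiff_smul_eq_zero (U := Ioo 0 l)
    (μ := edgeMeasure l) (f := fun x => f x - c)
    (((hf.integrable one_le_two).sub (integrable_const c)).locallyIntegrable.locallyIntegrableOn _)
    fun φ hφ hφc hφs => by
      -- Subtracting `m * φ₀` removes the mean of `φ`, so the difference is the derivative of a test
      -- function and the hypothesis applies.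
      set m := ∫ x, φ x ∂edgeMeasure l with hm
      obtain ⟨ψ, hψ, hψc, hψs, hψd⟩ := exists_test_deriv_eq hl
        (hφ.sub (contDiff_const (c := m) |>.mul hφ₀)) (hφc.sub (hφ₀c.mul_left (f := fun _ => m)))
        ((tsupport_sub φ _).trans (union_subset hφs ((tsupport_mul_subset_right).trans hφ₀s)))
        (by
          rw [← integral_edgeMeasure hl.le]
          rw [integral_sub (hint hφ.continuous) ((hint hφ₀.continuous).const_mul m),
            integral_const_mul, hφ₀i]
          simp [hm])
      have h1 := h ψ hψ hψc hψs
      rw [hψd] at h1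
      have h2 : ∀ x, f x * (φ x - m * φ₀ x) = f x * φ x - m * (f x * φ₀ x) := fun x => by
        ring
      simp_rw [h2] at h1
      rw [integral_sub (hfint hφ.continuous) ((hfint hφ₀.continuous).const_mul m),
        integral_const_mul, ← hc] at h1
      have h3 : ∀ x, φ x • (f x - c) = f x * φ x - c * φ x := fun x => by
        rw [smul_eq_mul]; ring
      simp_rw [h3]
      rw [integral_sub (hfint hφ.continuous) ((hint hφ.continuous).const_mul c),
        integral_const_mul]
      linarith
  have hIoo : ∀ᵐ x ∂edgeMeasure l, x ∈ Ioo 0 l := by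
    rw [edgeMeasure, ← restrict_Ioo_eq_restrict_Icc]
    exact ae_restrict_mem measurableSet_Ioo
  filter_upwards [key, hIoo] with x hx hx'
  exact sub_eq_zero.mp (hx hx')

/-- `f` minus the integral of `g` has weak derivative zero, hence is constant almost everywhere, and
by continuity everywhere on `[0, l]`. This gives pointwise meaning to the vertex values. -/
theorem HasSobolevDeriv.isPrimitive (h : HasSobolevDeriv l f g) (hl : 0 < l)
    (hf : ContinuousOn f (Icc 0 l)) : IsPrimitive l f g := by
  have hF := IsPrimitive.of_integral h.memLp_deriv 0
  have hFs := hF.hasSobolevDeriv hl.le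
  obtain ⟨c, hc⟩ := exists_ae_eq_const_of_integral_mul_deriv hl (h.memLp.sub hFs.memLp)
    fun φ hφ hφc hφs => by
      have hd := (hφ.continuous_deriv (by simp)).continuousOn (s := Icc 0 l)
      simp only [Pi.sub_apply, sub_mul]
      rw [integral_sub ((MemLp.mul_continuousOn_edge h.memLp hd).integrable one_le_two)
        ((MemLp.mul_continuousOn_edge hFs.memLp hd).integrable one_le_two)]
      erw [h.integral_eq φ hφ hφc hφs, hFs.integral_eq φ hφ hφc hφs]
      ring
  have heq := Measure.eqOn_Icc_of_ae_eq volume hl.ne hc (hf.sub hF.continuousOn) continuousOn_const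
  refine ⟨h.memLp_deriv, fun x hx => ?_⟩
  have h1 := heq hx
  have h2 := heq (left_mem_Icc.mpr hl.le)
  simp at h1 h2
  linarith

end Edge

/-! ### Bounded operators in `L₂` of an edge. -/

section EdgeOperators

open scoped InnerProductSpace

variable {l : ℝ}

theorem inner_edge (hl : 0 ≤ l) (f g : Lp ℝ 2 (edgeMeasure l)) :
    ⟪f, g⟫_ℝ = ∫ x in 0..l, f x * g x := by
  rw [L2.inner_def, integral_edgeMeasure hl]
  simp only [RCLike.inner_apply, conj_trivial, mul_comm]

theorem norm_sq_edge (hl : 0 ≤ l) (f : Lp ℝ 2 (edgeMeasure l)) :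
    ‖f‖ ^ 2 = ∫ x in 0..l, f x ^ 2 := by
  rw [← real_inner_self_eq_norm_sq, inner_edge hl]
  simp only [sq]

theorem intervalIntegral_congr_edge (hl : 0 ≤ l) {f g : ℝ → ℝ} (h : f =ᵐ[edgeMeasure l] g) :
    ∫ x in 0..l, f x = ∫ x in 0..l, g x := by
  rw [← integral_edgeMeasure hl, ← integral_edgeMeasure hl]
  exact integral_congr_ae h

/-- Integration over `[0, x]` as a functional on `L₂(0, l)`. -/
noncomputable def edgeIntegral (l x : ℝ) : Lp ℝ 2 (edgeMeasure l) →L[ℝ] ℝ :=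
  innerSL ℝ (indicatorConstLp 2 (measurableSet_Ioc (a := (0 : ℝ)) (b := x))
    (measure_ne_top (edgeMeasure l) _) (1 : ℝ))

theorem edgeIntegral_apply {x : ℝ} (hx : x ∈ Icc 0 l) (g : Lp ℝ 2 (edgeMeasure l)) :
    edgeIntegral l x g = ∫ t in 0..x, g t := by
  rw [edgeIntegral, innerSL_apply_apply, L2.inner_indicatorConstLp_one,
    intervalIntegral.integral_of_le hx.1, Measure.restrict_restrict measurableSet_Ioc,
    inter_eq_left.mpr (Ioc_subset_Icc_self.trans (Icc_subset_Icc_right hx.2))]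

theorem isPrimitive_edge (c : ℝ) (g : Lp ℝ 2 (edgeMeasure l)) :
    IsPrimitive l (fun x => c + ∫ t in 0..x, g t) g :=
  IsPrimitive.of_integral (Lp.memLp g) c

/-- The operator `g ↦ ∫₀ˣ g` in `L₂(0, l)`. -/
noncomputable def volterra (hl : 0 < l) :
    Lp ℝ 2 (edgeMeasure l) →L[ℝ] Lp ℝ 2 (edgeMeasure l) :=
  LinearMap.mkContinuous
    { toFun := fun g => ((isPrimitive_edge 0 g).continuousOn.memLp_edge 2).toLp
      map_add' := fun g₁ g₂ => by
        rw [← MemLp.toLp_add, MemLp.toLp_eq_toLp_iff]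
        refine (ae_restrict_iff' measurableSet_Icc).mpr (Filter.Eventually.of_forall fun x hx => ?_)
        simp only [Pi.add_apply, zero_add, ← edgeIntegral_apply hx, map_add]
      map_smul' := fun c g => by
        rw [← MemLp.toLp_const_smul, MemLp.toLp_eq_toLp_iff]
        refine (ae_restrict_iff' measurableSet_Icc).mpr (Filter.Eventually.of_forall fun x hx => ?_)
        simp only [Pi.smul_apply, zero_add, ← edgeIntegral_apply hx, map_smul, RingHom.id_apply] }
    l fun g => by
      refine (sq_le_sq₀ (norm_nonneg _) (by positivity)).mp ?_
      -- The primitive vanishes at `0`, so a single cell suffices.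
      have h := (isPrimitive_edge 0 g).integral_sq_le_of_nodes hl one_pos (by simp)
      rw [mul_pow, norm_sq_edge hl.le, norm_sq_edge hl.le]
      refine le_trans (le_of_eq ?_) (h.trans (by simp))
      refine intervalIntegral_congr_edge hl.le ?_
      filter_upwards [((isPrimitive_edge 0 g).continuousOn.memLp_edge 2).coeFn_toLp] with x hx
      exact congrArg (· ^ 2) hx

theorem volterra_ae (hl : 0 < l) (g : Lp ℝ 2 (edgeMeasure l)) :
    volterra hl g =ᵐ[edgeMeasure l] fun x => ∫ t in 0..x, g t := by
  filter_upwards [((isPrimitive_edge 0 g).continuousOn.memLp_edge 2).coeFn_toLp] with x hx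
  exact hx.trans (zero_add _)

/-- The inner product of `L₂(0, l)` as a bilinear map. -/
noncomputable def pairEdge (l : ℝ) :
    Lp ℝ 2 (edgeMeasure l) →L[ℝ] Lp ℝ 2 (edgeMeasure l) →L[ℝ] ℝ :=
  (ContinuousLinearMap.mul ℝ ℝ).lpPairing (edgeMeasure l) 2 2

theorem pairEdge_apply (hl : 0 ≤ l) (f g : Lp ℝ 2 (edgeMeasure l)) :
    pairEdge l f g = ∫ x in 0..l, f x * g x := by
  rw [pairEdge, ContinuousLinearMap.lpPairing_eq_integral, integral_edgeMeasure hl]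
  rfl

/-- Multiplication by a bounded function in `L₂(0, l)`. -/
noncomputable def mulEdge {m : ℝ → ℝ} (hm : MemLp m ⊤ (edgeMeasure l)) :
    Lp ℝ 2 (edgeMeasure l) →L[ℝ] Lp ℝ 2 (edgeMeasure l) :=
  (ContinuousLinearMap.mul ℝ ℝ).holderL (edgeMeasure l) ⊤ 2 2 hm.toLp

theorem mulEdge_ae {m : ℝ → ℝ} (hm : MemLp m ⊤ (edgeMeasure l)) (g : Lp ℝ 2 (edgeMeasure l)) :
    mulEdge hm g =ᵐ[edgeMeasure l] fun x => m x * g x := by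
  filter_upwards [(ContinuousLinearMap.mul ℝ ℝ).coeFn_holder (r := 2) hm.toLp g, hm.coeFn_toLp]
    with x h1 h2
  refine Eq.trans h1 ?_
  simp [h2]

end EdgeOperators

/-! ### The `H¹` space of the graph and the form on it. -/

namespace MetricGraph

open scoped InnerProductSpace

variable {V E : Type*} (Γ : MetricGraph V E)

theorem len_nonneg (e : E) : 0 ≤ Γ.len e := (Γ.len_pos e).le

theorem endCoord_mem (h : E × Bool) : Γ.endCoord h ∈ Icc 0 (Γ.len h.1) := by
  rcases h with ⟨e, _ | _⟩
  · exact left_mem_Icc.mpr (Γ.len_nonneg e)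
  · exact right_mem_Icc.mpr (Γ.len_nonneg e)

variable [Fintype E]

/-- Functions on `Γ` that are in `H¹` on every edge, given by their values at the ends `0` of the
edges and their derivatives. -/
abbrev PreH1 : Type _ := WithLp 2 (EuclideanSpace ℝ E × Γ.L2)

/-- The value at the end `0` of the edge `e`. -/
noncomputable def startValue (e : E) : Γ.PreH1 →L[ℝ] ℝ :=
  EuclideanSpace.proj e ∘L WithLp.fstL 2 ℝ _ _

/-- The derivative on the edge `e`. -/
noncomputable def slope (e : E) : Γ.PreH1 →L[ℝ] Lp ℝ 2 (edgeMeasure (Γ.len e)) :=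
  PiLp.proj 2 (fun e : E => Lp ℝ 2 (edgeMeasure (Γ.len e))) e ∘L WithLp.sndL 2 ℝ _ _

/-- The continuous representative. -/
noncomputable def toFun (w : Γ.PreH1) (e : E) (x : ℝ) : ℝ :=
  Γ.startValue e w + ∫ t in 0..x, Γ.slope e w t

theorem isPrimitive_toFun (w : Γ.PreH1) (e : E) :
    IsPrimitive (Γ.len e) (Γ.toFun w e) (Γ.slope e w) :=
  isPrimitive_edge _ _

theorem continuousOn_toFun (w : Γ.PreH1) (e : E) : ContinuousOn (Γ.toFun w e) (Icc 0 (Γ.len e)) :=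
  (Γ.isPrimitive_toFun w e).continuousOn

theorem toFun_zero (w : Γ.PreH1) (e : E) : Γ.toFun w e 0 = Γ.startValue e w := by
  simp [toFun]

/-- Evaluation at a point. -/
noncomputable def evalAt (e : E) (x : ℝ) : Γ.PreH1 →L[ℝ] ℝ :=
  Γ.startValue e + edgeIntegral (Γ.len e) x ∘L Γ.slope e

theorem evalAt_apply {e : E} {x : ℝ} (hx : x ∈ Icc 0 (Γ.len e)) (w : Γ.PreH1) :
    Γ.evalAt e x w = Γ.toFun w e x := by
  simp [evalAt, toFun, edgeIntegral_apply hx]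

/-- Evaluation at an edge end. -/
noncomputable def evalEnd (h : E × Bool) : Γ.PreH1 →L[ℝ] ℝ := Γ.evalAt h.1 (Γ.endCoord h)

theorem evalEnd_apply (h : E × Bool) (w : Γ.PreH1) :
    Γ.evalEnd h w = Γ.endValue (Γ.toFun w) h :=
  Γ.evalAt_apply (Γ.endCoord_mem h) w

/-- The class in `L₂` on the edge `e`. -/
noncomputable def edgeClass (e : E) : Γ.PreH1 →L[ℝ] Lp ℝ 2 (edgeMeasure (Γ.len e)) :=
  (Γ.startValue e).smulRight ((memLp_const (1 : ℝ)).toLp) + volterra (Γ.len_pos e) ∘L Γ.slope e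

theorem edgeClass_ae (w : Γ.PreH1) (e : E) :
    Γ.edgeClass e w =ᵐ[edgeMeasure (Γ.len e)] Γ.toFun w e := by
  have h1 : MemLp (fun _ : ℝ => (1 : ℝ)) 2 (edgeMeasure (Γ.len e)) := memLp_const 1
  filter_upwards [Lp.coeFn_add (Γ.startValue e w • h1.toLp) (volterra (Γ.len_pos e) (Γ.slope e w)),
    Lp.coeFn_smul (Γ.startValue e w) h1.toLp, h1.coeFn_toLp,
    volterra_ae (Γ.len_pos e) (Γ.slope e w)] with x e1 e2 e3 e4
  refine e1.trans ?_
  rw [Pi.add_apply, e2, Pi.smul_apply, e3, e4]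
  simp [toFun]

/-- The inclusion into `L₂(Γ)`. -/
noncomputable def toL2 : Γ.PreH1 →L[ℝ] Γ.L2 :=
  (PiLp.continuousLinearEquiv 2 ℝ fun e : E => Lp ℝ 2 (edgeMeasure (Γ.len e))).symm ∘L
    ContinuousLinearMap.pi Γ.edgeClass

theorem toL2_ae (w : Γ.PreH1) (e : E) : Γ.toL2 w e =ᵐ[edgeMeasure (Γ.len e)] Γ.toFun w e :=
  Γ.edgeClass_ae w e

theorem inner_toL2 (f : Γ.L2) (v : Γ.PreH1) :
    ⟪f, Γ.toL2 v⟫_ℝ = ∑ e, ∫ x in 0..Γ.len e, f e x * Γ.toFun v e x := by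
  rw [PiLp.inner_apply]
  refine Finset.sum_congr rfl fun e _ => ?_
  rw [inner_edge (Γ.len_nonneg e)]
  refine intervalIntegral_congr_edge (Γ.len_nonneg e) ?_
  filter_upwards [Γ.toL2_ae v e] with x hx
  rw [hx]

theorem norm_toL2_sq (w : Γ.PreH1) :
    ‖Γ.toL2 w‖ ^ 2 = ∑ e, ∫ x in 0..Γ.len e, Γ.toFun w e x ^ 2 := by
  rw [← real_inner_self_eq_norm_sq, inner_toL2]
  refine Finset.sum_congr rfl fun e _ => intervalIntegral_congr_edge (Γ.len_nonneg e) ?_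
  filter_upwards [Γ.toL2_ae w e] with x hx
  rw [hx, sq]

theorem norm_preH1_sq (w : Γ.PreH1) :
    ‖w‖ ^ 2 = ∑ e, (Γ.toFun w e 0 ^ 2 + ∫ x in 0..Γ.len e, Γ.slope e w x ^ 2) := by
  rw [WithLp.prod_norm_sq_eq_of_L2, EuclideanSpace.norm_sq_eq, PiLp.norm_sq_eq_of_L2,
    Finset.sum_add_distrib]
  congr 1
  · refine Finset.sum_congr rfl fun e _ => ?_
    rw [toFun_zero, Real.norm_eq_abs, sq_abs]; rfl
  · exact Finset.sum_congr rfl fun e _ => norm_sq_edge (Γ.len_nonneg e) _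

/-- The initial values and the classes of the derivatives are the coordinates of the space. Concrete
test functions enter the Hilbert space this way. -/
theorem exists_preH1 {f g : E → ℝ → ℝ} (h : ∀ e, IsPrimitive (Γ.len e) (f e) (g e)) :
    ∃ w : Γ.PreH1, (∀ e, ∀ x ∈ Icc 0 (Γ.len e), Γ.toFun w e x = f e x) ∧
      ∀ e, Γ.slope e w =ᵐ[edgeMeasure (Γ.len e)] g e := by
  let w : Γ.PreH1 := WithLp.toLp 2 (WithLp.toLp 2 fun e => f e 0,
    WithLp.toLp 2 fun e => (h e).memLp.toLp)
  have hs : ∀ e, Γ.slope e w =ᵐ[edgeMeasure (Γ.len e)] g e := fun e => (h e).memLp.coeFn_toLp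
  refine ⟨w, fun e x hx => ?_, hs⟩
  rw [((Γ.isPrimitive_toFun w e).congr_right (hs e)).eq_add x hx, (h e).eq_add x hx, toFun_zero]
  rfl

/-- The functions that are continuous at the vertices. -/
noncomputable def formSpace : Submodule ℝ Γ.PreH1 where
  carrier := {w | ∀ h h' : E × Bool, Γ.vertex h = Γ.vertex h' → Γ.evalEnd h w = Γ.evalEnd h' w}
  add_mem' := fun {a b} ha hb h h' hv => by rw [map_add, map_add, ha h h' hv, hb h h' hv]
  zero_mem' := fun h h' _ => by rw [map_zero, map_zero]
  smul_mem' := fun c a ha h h' hv => by rw [map_smul, map_smul, ha h h' hv]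

theorem mem_formSpace {w : Γ.PreH1} : w ∈ Γ.formSpace ↔ ∀ h h' : E × Bool,
    Γ.vertex h = Γ.vertex h' → Γ.endValue (Γ.toFun w) h = Γ.endValue (Γ.toFun w) h' := by
  simp only [← evalEnd_apply]
  exact Iff.rfl

instance : CompleteSpace Γ.formSpace := by
  have : (Γ.formSpace : Set Γ.PreH1) = ⋂ (h : E × Bool) (h' : E × Bool)
      (_ : Γ.vertex h = Γ.vertex h'), {w | Γ.evalEnd h w = Γ.evalEnd h' w} := by
    ext w; simp [formSpace]
  refine IsComplete.completeSpace_coe (IsClosed.isComplete ?_)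
  rw [this]
  exact isClosed_iInter fun h => isClosed_iInter fun h' => isClosed_iInter fun _ =>
    isClosed_eq (Γ.evalEnd h).continuous (Γ.evalEnd h').continuous

/-- The bilinear form `∑ₑ ∫ (H u' v' + κ² u v) + α ∑ᵥ u(v) v(v)`, the last sum being distributed over
the edge ends. -/
noncomputable def form {H κ : E → ℝ → ℝ} (hH : ∀ e, MemLp (H e) ⊤ (edgeMeasure (Γ.len e)))
    (hκ : ∀ e, MemLp (fun x => κ e x ^ 2) ⊤ (edgeMeasure (Γ.len e))) (α : ℝ) :
    Γ.PreH1 →L[ℝ] Γ.PreH1 →L[ℝ] ℝ :=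
  ∑ e, ((pairEdge _).bilinearComp (mulEdge (hH e) ∘L Γ.slope e) (Γ.slope e) +
    (pairEdge _).bilinearComp (mulEdge (hκ e) ∘L Γ.edgeClass e) (Γ.edgeClass e)) +
  ∑ h : E × Bool, (α / Γ.degree (Γ.vertex h)) •
    (ContinuousLinearMap.mul ℝ ℝ).bilinearComp (Γ.evalEnd h) (Γ.evalEnd h)

theorem form_apply {H κ : E → ℝ → ℝ} (hH : ∀ e, MemLp (H e) ⊤ (edgeMeasure (Γ.len e)))
    (hκ : ∀ e, MemLp (fun x => κ e x ^ 2) ⊤ (edgeMeasure (Γ.len e))) (α : ℝ) (w v : Γ.PreH1) :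
    Γ.form hH hκ α w v =
      ∑ e, ((∫ x in 0..Γ.len e, H e x * Γ.slope e w x * Γ.slope e v x) +
        ∫ x in 0..Γ.len e, κ e x ^ 2 * Γ.toFun w e x * Γ.toFun v e x) +
      ∑ h : E × Bool, α / Γ.degree (Γ.vertex h) *
        (Γ.endValue (Γ.toFun w) h * Γ.endValue (Γ.toFun v) h) := by
  rw [form]
  simp only [add_apply, sum_apply, smul_apply,
    ContinuousLinearMap.bilinearComp_apply, ContinuousLinearMap.comp_apply, 
    ContinuousLinearMap.mul_apply', evalEnd_apply, smul_eq_mul]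
  congr 1
  refine Finset.sum_congr rfl fun e _ => ?_
  rw [pairEdge_apply (Γ.len_nonneg e), pairEdge_apply (Γ.len_nonneg e)]
  congr 1
  · refine intervalIntegral_congr_edge (Γ.len_nonneg e) ?_
    filter_upwards [mulEdge_ae (hH e) (Γ.slope e w)] with x hx
    rw [hx]
  · refine intervalIntegral_congr_edge (Γ.len_nonneg e) ?_
    filter_upwards [mulEdge_ae (hκ e) (Γ.edgeClass e w), Γ.edgeClass_ae w e, Γ.edgeClass_ae v e]
      with x h1 h2 h3
    rw [h1, h2, h3]

theorem form_comm {H κ : E → ℝ → ℝ} (hH : ∀ e, MemLp (H e) ⊤ (edgeMeasure (Γ.len e)))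
    (hκ : ∀ e, MemLp (fun x => κ e x ^ 2) ⊤ (edgeMeasure (Γ.len e))) (α : ℝ) (w v : Γ.PreH1) :
    Γ.form hH hκ α w v = Γ.form hH hκ α v w := by
  rw [form_apply, form_apply]
  congr 1
  · refine Finset.sum_congr rfl fun e _ => ?_
    congr 2 <;> (ext x; ring)
  · exact Finset.sum_congr rfl fun h _ => by ring

end MetricGraph

/-! ### The weak equation on one edge. -/

section Edge

variable {l : ℝ}

theorem intervalIntegral_eq_zero_edge (hl : 0 ≤ l) {f : ℝ → ℝ} (h : f =ᵐ[edgeMeasure l] 0) :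
    ∫ x in 0..l, f x = 0 := by
  rw [intervalIntegral_congr_edge hl h]
  simp

/-- The weak form of `a' = b`. -/
theorem exists_ae_eq_const_add_integral (hl : 0 < l) {a b : ℝ → ℝ}
    (ha : MemLp a 2 (edgeMeasure l)) (hb : MemLp b 2 (edgeMeasure l))
    (h : ∀ Φ φ : ℝ → ℝ, IsPrimitive l Φ φ → Φ 0 = 0 → Φ l = 0 →
      (∫ x in 0..l, a x * φ x) + ∫ x in 0..l, b x * Φ x = 0) :
    ∃ c : ℝ, a =ᵐ[edgeMeasure l] fun x => c + ∫ t in 0..x, b t := by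
  have h0 := left_mem_Icc.mpr hl.le
  have h1 := right_mem_Icc.mpr hl.le
  have hF := IsPrimitive.of_integral hb 0
  set F : ℝ → ℝ := fun x => 0 + ∫ t in 0..x, b t with hFdef
  -- With this mean value, `φ` integrates to zero and its primitive vanishes at both ends. Testing
  -- with that primitive yields `∫ φ² = 0`.
  set c : ℝ := (∫ x in 0..l, (a x - F x)) / l with hc
  have hG : MemLp (fun x => a x - F x) 2 (edgeMeasure l) := ha.sub (hF.continuousOn.memLp_edge 2)
  have hφ : MemLp (fun x => a x - F x - c) 2 (edgeMeasure l) := hG.sub (memLp_const c)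
  set φ : ℝ → ℝ := fun x => a x - F x - c with hφdef
  have hφ0 : ∫ x in 0..l, φ x = 0 := by
    rw [hφdef, intervalIntegral.integral_sub (MemLp.intervalIntegrable_edge hG h0 h1)
      intervalIntegrable_const, intervalIntegral.integral_const, hc, smul_eq_mul, sub_zero]
    field_simp
    simp
  have hΦ := IsPrimitive.of_integral hφ 0
  have hparts := hF.integral_deriv_mul hΦ h1
  have hweak := h _ _ hΦ (by simp) (by simpa using hφ0)
  have i1 : IntervalIntegrable (fun x => b x * (0 + ∫ t in 0..x, φ t)) volume 0 l :=
    MemLp.intervalIntegrable_edge (MemLp.mul_continuousOn_edge hb hΦ.continuousOn) h0 h1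
  have i2 : IntervalIntegrable (fun x => F x * φ x) volume 0 l := by
    have := MemLp.intervalIntegrable_edge (MemLp.mul_continuousOn_edge hφ hF.continuousOn) h0 h1
    simpa only [mul_comm] using this
  have i3 : IntervalIntegrable (fun x => a x * φ x) volume 0 l :=
    Integrable.intervalIntegrable_edge (ha.integrable_mul hφ) h0 h1
  have i4 : IntervalIntegrable φ volume 0 l := MemLp.intervalIntegrable_edge hφ h0 h1
  rw [intervalIntegral.integral_add i1 i2] at hparts
  have hsq : ∫ x in 0..l, φ x ^ 2 = 0 := by
    have : ∀ x, φ x ^ 2 = a x * φ x - F x * φ x - c * φ x := fun x => by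
      simp only [hφdef]; ring
    simp_rw [this]
    rw [intervalIntegral.integral_sub (i3.sub i2) (i4.const_mul c),
      intervalIntegral.integral_sub i3 i2, intervalIntegral.integral_const_mul, hφ0]
    simp only [intervalIntegral.integral_same, add_zero, sub_zero, mul_zero,
      zero_add, hφ0] at hparts hweak ⊢
    linarith
  rw [← integral_edgeMeasure hl.le, integral_eq_zero_iff_of_nonneg (fun x => sq_nonneg _)
    hφ.integrable_sq] at hsq
  refine ⟨c, ?_⟩
  filter_upwards [hsq] with x hx
  have : φ x = 0 := by simpa using hx
  simp only [hφdef, hFdef] at this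
  linarith

/-- The difference of reciprocals has denominator `H x * H y ≥ H₀²`. It is needed because the
derivative of a weak solution is the flux divided by `H`. -/
theorem LipschitzOnWith.inv_of_le {K : NNReal} {H : ℝ → ℝ} {s : Set ℝ} {H₀ : ℝ} (hH₀ : 0 < H₀)
    (hH : LipschitzOnWith K H s) (hle : ∀ x ∈ s, H₀ ≤ H x) :
    LipschitzOnWith (Real.toNNReal (K / H₀ ^ 2)) (fun x => (H x)⁻¹) s := by
  refine LipschitzOnWith.of_dist_le_mul fun x hx y hy => ?_
  have hx' := hH₀.trans_le (hle x hx)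
  have hy' := hH₀.trans_le (hle y hy)
  have h1 := hH.dist_le_mul x hx y hy
  rw [Real.coe_toNNReal _ (by positivity), dist_inv_inv₀ hx'.ne' hy'.ne', Real.norm_of_nonneg hx'.le,
    Real.norm_of_nonneg hy'.le, div_mul_eq_mul_div]
  refine div_le_div₀ (by positivity) h1 (by positivity) ?_
  rw [sq]
  exact mul_le_mul (hle x hx) (hle y hy) hH₀.le hx'.le

end Edge

/-! ### Equivalence of the operator equation and its weak form. -/

namespace MetricGraph

open scoped InnerProductSpace

variable {V E : Type*} [Fintype E] (Γ : MetricGraph V E)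

variable {Γ} in
/-- A function supported on one edge that vanishes at its ends. -/
theorem exists_single {e : E} {f g : ℝ → ℝ} (h : IsPrimitive (Γ.len e) f g) (hf0 : f 0 = 0)
    (hfl : f (Γ.len e) = 0) :
    ∃ v ∈ Γ.formSpace, (∀ x ∈ Icc 0 (Γ.len e), Γ.toFun v e x = f x) ∧
      Γ.slope e v =ᵐ[edgeMeasure (Γ.len e)] g ∧ (∀ h, Γ.endValue (Γ.toFun v) h = 0) ∧
      ∀ e' ≠ e, (∀ x ∈ Icc 0 (Γ.len e'), Γ.toFun v e' x = 0) ∧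
        Γ.slope e' v =ᵐ[edgeMeasure (Γ.len e')] 0 := by
  classical
  obtain ⟨v, hv, hs⟩ := Γ.exists_preH1 (f := fun e' => if e' = e then f else 0)
    (g := fun e' => if e' = e then g else 0) fun e' => by
      by_cases he : e' = e
      · subst he; simpa using h
      · simp only [he, if_false]
        exact ⟨MemLp.zero, fun x _ => by simp⟩
  have hend : ∀ h, Γ.endValue (Γ.toFun v) h = 0 := fun h => by
    rw [endValue, hv h.1 _ (Γ.endCoord_mem h)]
    rcases h with ⟨e', b⟩
    by_cases he : e' = e
    · subst he; cases b <;> simpa [endCoord]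
    · simp [he]
  refine ⟨v, Γ.mem_formSpace.mpr fun h h' _ => by rw [hend, hend], fun x hx => ?_, ?_, hend,
    fun e' he => ⟨fun x hx => ?_, ?_⟩⟩
  · simpa using hv e x hx
  · simpa using hs e
  · simpa [he] using hv e' x hx
  · simpa [he] using hs e'

theorem inner_toL2_of_single {e : E} {v : Γ.PreH1} {φ : ℝ → ℝ}
    (hv : ∀ x ∈ Icc 0 (Γ.len e), Γ.toFun v e x = φ x)
    (hv' : ∀ e' ≠ e, ∀ x ∈ Icc 0 (Γ.len e'), Γ.toFun v e' x = 0) (f : Γ.L2) :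
    ⟪f, Γ.toL2 v⟫_ℝ = ∫ x in 0..Γ.len e, f e x * φ x := by
  rw [inner_toL2, Finset.sum_eq_single e]
  · refine intervalIntegral.integral_congr fun x hx => ?_
    rw [uIcc_of_le (Γ.len_nonneg e)] at hx
    simp only [hv x hx]
  · intro e' _ he'
    refine intervalIntegral_eq_zero_edge (Γ.len_nonneg e') ?_
    filter_upwards [ae_restrict_mem measurableSet_Icc] with x hx
    simp [hv' e' he' x hx]
  · simp

variable {H κ : E → ℝ → ℝ} (hH : ∀ e, MemLp (H e) ⊤ (edgeMeasure (Γ.len e)))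
    (hκ : ∀ e, MemLp (fun x => κ e x ^ 2) ⊤ (edgeMeasure (Γ.len e))) (α : ℝ)

theorem form_single {e : E} {w v : Γ.PreH1} {Φ φ : ℝ → ℝ}
    (hv : ∀ x ∈ Icc 0 (Γ.len e), Γ.toFun v e x = Φ x)
    (hs : Γ.slope e v =ᵐ[edgeMeasure (Γ.len e)] φ)
    (hend : ∀ h, Γ.endValue (Γ.toFun v) h = 0)
    (hv' : ∀ e' ≠ e, (∀ x ∈ Icc 0 (Γ.len e'), Γ.toFun v e' x = 0) ∧
        Γ.slope e' v =ᵐ[edgeMeasure (Γ.len e')] 0) :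
    Γ.form hH hκ α w v = (∫ x in 0..Γ.len e, H e x * Γ.slope e w x * φ x) +
        ∫ x in 0..Γ.len e, κ e x ^ 2 * Γ.toFun w e x * Φ x := by
  rw [form_apply, Finset.sum_eq_single e]
  · simp only [hend, mul_zero, Finset.sum_const_zero, add_zero]
    congr 1
    · refine intervalIntegral_congr_edge (Γ.len_nonneg e) ?_
      filter_upwards [hs] with x hx
      rw [hx]
    · refine intervalIntegral.integral_congr fun x hx => ?_
      rw [uIcc_of_le (Γ.len_nonneg e)] at hx
      simp only [hv x hx]
  · intro e' _ he'
    rw [intervalIntegral_eq_zero_edge (Γ.len_nonneg e'), intervalIntegral_eq_zero_edge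
      (Γ.len_nonneg e'), add_zero]
    · filter_upwards [ae_restrict_mem measurableSet_Icc] with x hx
      simp [(hv' e' he').1 x hx]
    · filter_upwards [(hv' e' he').2] with x hx
      simp [hx]
  · simp

/-- Green's formula: integration by parts on every edge. -/
theorem form_sub_inner {w : Γ.PreH1} {u₀ p r : E → ℝ → ℝ} {f : Γ.L2}
    (hw : ∀ e, ∀ x ∈ Icc 0 (Γ.len e), Γ.toFun w e x = u₀ e x)
    (hp : ∀ e, Γ.slope e w =ᵐ[edgeMeasure (Γ.len e)] p e)
    (hr : ∀ e, IsPrimitive (Γ.len e) (fun x => H e x * p e x) (r e))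
    (hf : ∀ e, f e =ᵐ[edgeMeasure (Γ.len e)] fun x => - r e x + κ e x ^ 2 * u₀ e x)
    (v : Γ.PreH1) :
    Γ.form hH hκ α w v - ⟪f, Γ.toL2 v⟫_ℝ = ∑ h : E × Bool,
      (α / Γ.degree (Γ.vertex h) * Γ.endValue u₀ h - Γ.endValue H h * Γ.outDeriv p h) *
        Γ.endValue (Γ.toFun v) h := by
  have hedge : ∀ e, (∫ x in 0..Γ.len e, H e x * Γ.slope e w x * Γ.slope e v x) +
      (∫ x in 0..Γ.len e, κ e x ^ 2 * Γ.toFun w e x * Γ.toFun v e x) -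
      ∫ x in 0..Γ.len e, f e x * Γ.toFun v e x =
      ∑ b : Bool, -(Γ.endValue H (e, b) * Γ.outDeriv p (e, b) *
        Γ.endValue (Γ.toFun v) (e, b)) := by
    intro e
    have h0 := left_mem_Icc.mpr (Γ.len_nonneg e)
    have h1 := right_mem_Icc.mpr (Γ.len_nonneg e)
    have hvp := Γ.isPrimitive_toFun v e
    have hκw : MemLp (fun x => κ e x ^ 2 * Γ.toFun w e x) 2 (edgeMeasure (Γ.len e)) :=
      MemLp.mul ((Γ.continuousOn_toFun w e).memLp_edge 2) (hκ e)
    have hHw : MemLp (fun x => H e x * Γ.slope e w x) 2 (edgeMeasure (Γ.len e)) :=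
      MemLp.mul (Lp.memLp (Γ.slope e w)) (hH e)
    have i1 : IntervalIntegrable (fun x => H e x * Γ.slope e w x * Γ.slope e v x) volume 0
        (Γ.len e) := Integrable.intervalIntegrable_edge (hHw.integrable_mul hvp.memLp) h0 h1
    have i2 : IntervalIntegrable (fun x => κ e x ^ 2 * Γ.toFun w e x * Γ.toFun v e x) volume 0
        (Γ.len e) := MemLp.intervalIntegrable_edge
          (MemLp.mul_continuousOn_edge hκw hvp.continuousOn) h0 h1
    have i3 : IntervalIntegrable (fun x => f e x * Γ.toFun v e x) volume 0
        (Γ.len e) := MemLp.intervalIntegrable_edge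
          (MemLp.mul_continuousOn_edge (Lp.memLp (f e)) hvp.continuousOn) h0 h1
    have hparts := (hr e).integral_deriv_mul hvp h1
    rw [← intervalIntegral.integral_add i1 i2, ← intervalIntegral.integral_sub (i1.add i2) i3]
    -- The potential terms cancel against `f`, leaving the derivative of the product of flux and
    -- test function.
    have hEq : ∫ x in 0..Γ.len e, (H e x * Γ.slope e w x * Γ.slope e v x +
        κ e x ^ 2 * Γ.toFun w e x * Γ.toFun v e x - f e x * Γ.toFun v e x) =
        ∫ x in 0..Γ.len e, (r e x * Γ.toFun v e x + H e x * p e x * Γ.slope e v x) := by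
      refine intervalIntegral_congr_edge (Γ.len_nonneg e) ?_
      filter_upwards [hp e, hf e, ae_restrict_mem measurableSet_Icc] with x e1 e2 hx
      rw [e1, e2, hw e x hx]
      ring
    rw [hEq, hparts, Fintype.sum_bool]
    simp only [endValue, endCoord, outDeriv]
    ring
  rw [form_apply, inner_toL2, add_sub_right_comm, ← Finset.sum_sub_distrib,
    Finset.sum_congr rfl fun e _ => hedge e, ← Fintype.sum_prod_type', ← Finset.sum_add_distrib]
  refine Finset.sum_congr rfl fun h _ => ?_
  have : Γ.endValue (Γ.toFun w) h = Γ.endValue u₀ h := hw h.1 _ (Γ.endCoord_mem h)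
  rw [this]
  ring

theorem mem_star {v : V} {h : E × Bool} : h ∈ Γ.star v ↔ Γ.vertex h = v := by
  simp [star]

/-- Each of the `degree v` ends carries `α / degree v`, and `u₀` and `H` are constant on the star,
so the boundary terms of Green's formula add up to the Kirchhoff defect at `v`. -/
theorem sum_star_eq {u₀ p : E → ℝ → ℝ}
    (hu : ∀ h h' : E × Bool, Γ.vertex h = Γ.vertex h' → Γ.endValue u₀ h = Γ.endValue u₀ h')
    (hHv : ∀ h h' : E × Bool, Γ.vertex h = Γ.vertex h' → Γ.endValue H h = Γ.endValue H h')
    {v : V} {h : E × Bool} (hv : h ∈ Γ.star v) :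
    ∑ h' ∈ Γ.star v, (α / Γ.degree (Γ.vertex h') * Γ.endValue u₀ h' -
      Γ.endValue H h' * Γ.outDeriv p h') =
    α * Γ.endValue u₀ h - Γ.endValue H h * ∑ h' ∈ Γ.star v, Γ.outDeriv p h' := by
  have hvv := Γ.mem_star.mp hv
  have hd : (Γ.degree v : ℝ) ≠ 0 := by
    rw [degree, Nat.cast_ne_zero]
    exact Finset.card_ne_zero_of_mem hv
  rw [Finset.sum_sub_distrib, Finset.mul_sum]
  congr 1
  · rw [Finset.sum_congr rfl (g := fun _ => α / Γ.degree v * Γ.endValue u₀ h) fun h' hh' => ?_,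
      Finset.sum_const, nsmul_eq_mul, ← degree]
    · field_simp
    · rw [Γ.mem_star.mp hh', hu h' h ((Γ.mem_star.mp hh').trans hvv.symm)]
  · refine Finset.sum_congr rfl fun h' hh' => ?_
    rw [hHv h' h ((Γ.mem_star.mp hh').trans hvv.symm)]

variable {α}

/-- The boundary terms in Green's formula are grouped by vertex. The test function is constant on
each group and factors out, leaving the Kirchhoff defect, which is zero. -/
theorem OperatorEq.exists_weak
    (hHc : ∀ e, ContinuousOn (H e) (Icc 0 (Γ.len e)))
    (hHv : ∀ h h' : E × Bool, Γ.vertex h = Γ.vertex h' → Γ.endValue H h = Γ.endValue H h')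
    {u f : Γ.L2} (h : Γ.OperatorEq H κ α u f) :
    ∃ w ∈ Γ.formSpace, Γ.toL2 w = u ∧
      ∀ v ∈ Γ.formSpace, Γ.form hH hκ α w v = ⟪f, Γ.toL2 v⟫_ℝ := by
  classical
  obtain ⟨u₀, p, r, hu, hrep, hK, hr, hf⟩ := h
  obtain ⟨w, hw, hs⟩ := Γ.exists_preH1 (f := u₀) (g := p) fun e =>
    (hrep e).hasDeriv.isPrimitive (Γ.len_pos e) (hrep e).continuousOn
  have hend : ∀ h, Γ.endValue (Γ.toFun w) h = Γ.endValue u₀ h := fun h =>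
    hw h.1 _ (Γ.endCoord_mem h)
  refine ⟨w, Γ.mem_formSpace.mpr fun h h' hv => ?_, ?_, fun v hv => ?_⟩
  · rw [hend, hend, hK.continuous_at_vertex h h' hv]
  · refine PiLp.ext fun e => Lp.ext ?_
    filter_upwards [Γ.toL2_ae w e, hu e, ae_restrict_mem measurableSet_Icc] with x e1 e2 hx
    rw [e1, e2, hw e x hx]
  · rw [← sub_eq_zero, Γ.form_sub_inner hH hκ α hw hs
      (fun e => (hr e).isPrimitive (Γ.len_pos e) ((hHc e).mul (hrep e).continuousOn_deriv)) hf,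
      ← Finset.sum_fiberwise_of_maps_to (s := Finset.univ) (t := Finset.univ.image Γ.vertex)
        (g := Γ.vertex) (fun h _ => Finset.mem_image_of_mem _ (Finset.mem_univ h))]
    refine Finset.sum_eq_zero fun a ha => ?_
    obtain ⟨h, -, rfl⟩ := Finset.mem_image.mp ha
    have hstar : Finset.univ.filter (fun h' => Γ.vertex h' = Γ.vertex h) = Γ.star (Γ.vertex h) := by
      ext h'; simp [star]
    rw [hstar, Finset.sum_congr rfl fun h' hh' => by
      rw [Γ.mem_formSpace.mp hv h' h (Γ.mem_star.mp hh')], ← Finset.sum_mul,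
      Γ.sum_star_eq α hK.continuous_at_vertex hHv (Γ.mem_star.mpr rfl),
      hK.flux _ h (Γ.mem_star.mpr rfl), sub_self, zero_mul]

/-- A function with prescribed values at the vertices. -/
theorem exists_vertex_function (c : V → ℝ) :
    ∃ v ∈ Γ.formSpace, ∀ h, Γ.endValue (Γ.toFun v) h = c (Γ.vertex h) := by
  obtain ⟨v, hv, -⟩ := Γ.exists_preH1
    (f := fun e x => c (Γ.endpt e false) +
      x * ((c (Γ.endpt e true) - c (Γ.endpt e false)) / Γ.len e))
    (g := fun e _ => (c (Γ.endpt e true) - c (Γ.endpt e false)) / Γ.len e) fun e =>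
      IsPrimitive.of_hasDerivAt (fun x => by
        simpa using ((hasDerivAt_id x).mul_const
          ((c (Γ.endpt e true) - c (Γ.endpt e false)) / Γ.len e)).const_add (c (Γ.endpt e false)))
        continuous_const
  have hend : ∀ h, Γ.endValue (Γ.toFun v) h = c (Γ.vertex h) := fun h => by
    rw [endValue, hv h.1 _ (Γ.endCoord_mem h)]
    rcases h with ⟨e, b⟩
    have := (Γ.len_pos e).ne'
    cases b
    · simp [endCoord, vertex]
    · simp only [endCoord, vertex]; field_simp; ring
  exact ⟨v, Γ.mem_formSpace.mpr fun h h' hv => by rw [hend, hend, hv], hend⟩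

/-- Regularity of weak solutions. -/
theorem operatorEq_of_weak {H₀ : ℝ} (hH₀ : 0 < H₀)
    (hHH₀ : ∀ e, ∀ t ∈ Icc 0 (Γ.len e), H₀ ≤ H e t)
    (hHl : ∀ e, ∃ K : NNReal, LipschitzOnWith K (H e) (Icc 0 (Γ.len e)))
    (hHv : ∀ h h' : E × Bool, Γ.vertex h = Γ.vertex h' → Γ.endValue H h = Γ.endValue H h')
    {w : Γ.PreH1} (hw : w ∈ Γ.formSpace) {f : Γ.L2}
    (h : ∀ v ∈ Γ.formSpace, Γ.form hH hκ α w v = ⟪f, Γ.toL2 v⟫_ℝ) :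
    Γ.OperatorEq H κ α (Γ.toL2 w) f := by
  classical
  -- The equation prescribes the derivative of the flux.
  let r : E → ℝ → ℝ := fun e x => κ e x ^ 2 * Γ.toFun w e x - f e x
  have hκw : ∀ e, MemLp (fun x => κ e x ^ 2 * Γ.toFun w e x) 2 (edgeMeasure (Γ.len e)) := fun e =>
    MemLp.mul ((Γ.continuousOn_toFun w e).memLp_edge 2) (hκ e)
  have hr : ∀ e, MemLp (r e) 2 (edgeMeasure (Γ.len e)) := fun e => (hκw e).sub (Lp.memLp (f e))
  have hHw : ∀ e, MemLp (fun x => H e x * Γ.slope e w x) 2 (edgeMeasure (Γ.len e)) := fun e =>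
    MemLp.mul (Lp.memLp (Γ.slope e w)) (hH e)
  have hex : ∀ e, ∃ c : ℝ, (fun x => H e x * Γ.slope e w x) =ᵐ[edgeMeasure (Γ.len e)]
      fun x => c + ∫ t in 0..x, r e t := fun e => by
    -- Test functions living on one edge and vanishing at its ends see only the equation inside that
    -- edge.
    refine exists_ae_eq_const_add_integral (Γ.len_pos e) (hHw e) (hr e) fun Φ φ hΦ hΦ0 hΦl => ?_
    obtain ⟨v, hv, hvf, hvs, hvend, hv'⟩ := exists_single hΦ hΦ0 hΦl
    have h1 := h v hv
    rw [Γ.form_single hH hκ α hvf hvs hvend hv',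
      Γ.inner_toL2_of_single hvf (fun e' he' => (hv' e' he').1)] at h1
    have h0 := left_mem_Icc.mpr (Γ.len_nonneg e)
    have hl := right_mem_Icc.mpr (Γ.len_nonneg e)
    have hsub : ∫ x in 0..Γ.len e, r e x * Φ x =
        (∫ x in 0..Γ.len e, κ e x ^ 2 * Γ.toFun w e x * Φ x) - ∫ x in 0..Γ.len e, f e x * Φ x := by
      rw [← intervalIntegral.integral_sub
        (MemLp.intervalIntegrable_edge (MemLp.mul_continuousOn_edge (hκw e) hΦ.continuousOn) h0 hl)
        (MemLp.intervalIntegrable_edge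
          (MemLp.mul_continuousOn_edge (Lp.memLp (f e)) hΦ.continuousOn) h0 hl)]
      simp only [r, sub_mul]
    rw [hsub]
    linarith
  choose c hc using hex
  choose K hK using hHl
  -- The continuous representative of the derivative: the flux is a primitive and `1 / H` is
  -- Lipschitz, so the product is again in `H¹`.
  let p : E → ℝ → ℝ := fun e x => (c e + ∫ t in 0..x, r e t) * (H e x)⁻¹
  have hHpos : ∀ e, ∀ x ∈ Icc 0 (Γ.len e), H e x ≠ 0 := fun e x hx =>
    (hH₀.trans_le (hHH₀ e x hx)).ne'
  have hs : ∀ e, Γ.slope e w =ᵐ[edgeMeasure (Γ.len e)] p e := fun e => by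
    filter_upwards [hc e, ae_restrict_mem measurableSet_Icc] with x e1 hx
    have := hHpos e x hx
    simp only [p, ← e1]
    field_simp
  have hpp : ∀ e, ∃ q, IsPrimitive (Γ.len e) (p e) q := fun e =>
    ⟨_, (IsPrimitive.of_integral (hr e) (c e)).mul
      (IsPrimitive.of_lipschitzOn ((hK e).inv_of_le hH₀ (hHH₀ e)))⟩
  have hHp : ∀ e, ∀ x ∈ Icc 0 (Γ.len e), H e x * p e x = c e + ∫ t in 0..x, r e t :=
    fun e x hx => by
      have := hHpos e x hx
      simp only [p]
      field_simp
  have hHr : ∀ e, IsPrimitive (Γ.len e) (fun x => H e x * p e x) (r e) := fun e =>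
    ⟨hr e, fun x hx => by
      simp only [hHp e x hx, hHp e 0 (left_mem_Icc.mpr (Γ.len_nonneg e))]
      simp⟩
  have hf : ∀ e, f e =ᵐ[edgeMeasure (Γ.len e)] fun x => - r e x + κ e x ^ 2 * Γ.toFun w e x :=
    fun e => Filter.Eventually.of_forall fun x => by simp only [r]; ring
  refine ⟨Γ.toFun w, p, r, Γ.toL2_ae w, fun e => ?_, ⟨Γ.mem_formSpace.mp hw, fun v h₁ hh₁ => ?_⟩,
    fun e => (hHr e).hasSobolevDeriv (Γ.len_nonneg e), hf⟩
  · obtain ⟨q, hq⟩ := hpp e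
    exact ⟨Γ.continuousOn_toFun w e, hq.continuousOn,
      ((Γ.isPrimitive_toFun w e).congr_right (hs e)).hasSobolevDeriv (Γ.len_nonneg e),
      q, hq.hasSobolevDeriv (Γ.len_nonneg e)⟩
  -- A test function equal to `1` at `v` and `0` at the other vertices isolates the flux condition
  -- at `v`.
  · obtain ⟨z, hz, hzv⟩ := Γ.exists_vertex_function fun a => if a = v then (1 : ℝ) else 0
    have h1 := Γ.form_sub_inner hH hκ α (w := w) (fun e x _ => rfl) hs hHr hf z
    rw [h z hz, sub_self] at h1
    simp only [hzv, mul_ite, mul_one, mul_zero] at h1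
    rw [← Finset.sum_filter] at h1
    have hstar : Finset.univ.filter (fun h' => Γ.vertex h' = v) = Γ.star v := by
      ext h'; simp [star]
    rw [hstar, Γ.sum_star_eq α (Γ.mem_formSpace.mp hw) hHv hh₁] at h1
    linarith

end MetricGraph

/-! ### Orthogonality of sines and cosines. -/

section Trigonometric

variable {l : ℝ}

theorem integral_cos_int_mul_pi (hl : 0 < l) {m : ℤ} (hm : m ≠ 0) :
    ∫ x in 0..l, Real.cos (m * Real.pi / l * x) = 0 := by
  have hc : (m * Real.pi / l : ℝ) ≠ 0 := by
    have : (m : ℝ) ≠ 0 := by exact_mod_cast hm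
    have := Real.pi_ne_zero
    positivity
  rw [intervalIntegral.integral_comp_mul_left Real.cos hc, integral_cos, mul_zero, Real.sin_zero,
    div_mul_cancel₀ _ hl.ne', Real.sin_int_mul_pi]
  simp

/-- Product-to-sum formulas leave cosines of frequencies `i - j` and `i + j + 2`. The shift by one
keeps the second frequency nonzero, so only the first contributes, and only for `i = j`. -/
theorem integral_sin_mul_sin_and_cos_mul_cos (hl : 0 < l) (i j : ℕ) :
    (∫ x in 0..l, Real.sin ((i + 1) * Real.pi / l * x) * Real.sin ((j + 1) * Real.pi / l * x) =
      if i = j then l / 2 else 0) ∧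
    ∫ x in 0..l, Real.cos ((i + 1) * Real.pi / l * x) * Real.cos ((j + 1) * Real.pi / l * x) =
      if i = j then l / 2 else 0 := by
  have hint : ∀ m : ℤ, IntervalIntegrable (fun x => Real.cos (m * Real.pi / l * x)) volume 0 l :=
    fun m => (Real.continuous_cos.comp (continuous_const.mul continuous_id)).intervalIntegrable _ _
  have hsum : ∫ x in 0..l, Real.cos (((i + j + 2 : ℤ) : ℝ) * Real.pi / l * x) = 0 :=
    integral_cos_int_mul_pi hl (by omega)
  have hdiff : ∫ x in 0..l, Real.cos (((i - j : ℤ) : ℝ) * Real.pi / l * x) =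
      if i = j then l else 0 := by
    split_ifs with h
    · simp [h]
    · exact integral_cos_int_mul_pi hl (by omega)
  have hs : ∀ x : ℝ, ((i + 1) * Real.pi / l * x) - ((j + 1) * Real.pi / l * x) =
      ((i - j : ℤ) : ℝ) * Real.pi / l * x := fun x => by push_cast; ring
  have ha : ∀ x : ℝ, ((i + 1) * Real.pi / l * x) + ((j + 1) * Real.pi / l * x) =
      ((i + j + 2 : ℤ) : ℝ) * Real.pi / l * x := fun x => by push_cast; ring
  constructor
  · have : ∀ x : ℝ, Real.sin ((i + 1) * Real.pi / l * x) * Real.sin ((j + 1) * Real.pi / l * x) =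
        2⁻¹ * (Real.cos (((i - j : ℤ) : ℝ) * Real.pi / l * x) -
          Real.cos (((i + j + 2 : ℤ) : ℝ) * Real.pi / l * x)) := fun x => by
      rw [← hs, ← ha, Real.cos_sub, Real.cos_add]; ring
    simp_rw [this]
    rw [intervalIntegral.integral_const_mul, intervalIntegral.integral_sub (hint _) (hint _), hsum,
      hdiff]
    split_ifs <;> ring
  · have : ∀ x : ℝ, Real.cos ((i + 1) * Real.pi / l * x) * Real.cos ((j + 1) * Real.pi / l * x) =
        2⁻¹ * (Real.cos (((i - j : ℤ) : ℝ) * Real.pi / l * x) +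
          Real.cos (((i + j + 2 : ℤ) : ℝ) * Real.pi / l * x)) := fun x => by
      rw [← hs, ← ha, Real.cos_sub, Real.cos_add]; ring
    simp_rw [this]
    rw [intervalIntegral.integral_const_mul, intervalIntegral.integral_add (hint _) (hint _), hsum,
      hdiff]
    split_ifs <;> ring

end Trigonometric

theorem norm_sq_sum_smul_of_orthogonal {Y ι : Type*} [NormedAddCommGroup Y] [InnerProductSpace ℝ Y]
    [Fintype ι] [DecidableEq ι] {v : ι → Y} {a : ι → ℝ}
    (h : ∀ i j, inner ℝ (v i) (v j) = if i = j then a i else 0) (x : ι → ℝ) :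
    ‖∑ i, x i • v i‖ ^ 2 = ∑ i, x i ^ 2 * a i := by
  rw [← real_inner_self_eq_norm_sq, sum_inner]
  refine Finset.sum_congr rfl fun i _ => ?_
  simp only [inner_sum, real_inner_smul_left, real_inner_smul_right, h, mul_ite, mul_zero,
    Finset.sum_ite_eq, Finset.mem_univ, if_true]
  ring

/-! ### Path distance, degrees and edge lengths. -/

namespace MetricGraph

open scoped InnerProductSpace

section Geometry

variable {V E : Type*} {Γ : MetricGraph V E} {H : E → ℝ → ℝ}

theorem HasPath.nonneg {x y : E × ℝ} {r : ℝ} (h : Γ.HasPath x y r) : 0 ≤ r := by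
  induction h with
  | along => exact abs_nonneg _
  | through => exact le_rfl
  | concat _ _ _ _ _ _ _ h₁ h₂ => exact add_nonneg h₁ h₂

theorem HasPath.pathDist_le {x y : E × ℝ} {r : ℝ} (h : Γ.HasPath x y r) : Γ.pathDist x y ≤ r :=
  csInf_le ⟨0, fun _ hr => HasPath.nonneg hr⟩ h

theorem IsLipschitz.lipschitzOnWith (hH : Γ.IsLipschitz H) (e : E) :
    ∃ K : NNReal, LipschitzOnWith K (H e) (Icc 0 (Γ.len e)) := by
  obtain ⟨K, hK, h⟩ := hH
  refine ⟨⟨K, hK⟩, LipschitzOnWith.of_dist_le_mul fun x hx y hy => ?_⟩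
  rw [Real.dist_eq, Real.dist_eq]
  exact (h (e, x) hx (e, y) hy).trans
    (mul_le_mul_of_nonneg_left (HasPath.along e x y hx hy).pathDist_le hK)

/-- Ends at a common vertex are joined by a path of length zero, so `H(v)` is well defined. -/
theorem IsLipschitz.endValue_eq (hH : Γ.IsLipschitz H) {h h' : E × Bool}
    (hv : Γ.vertex h = Γ.vertex h') : Γ.endValue H h = Γ.endValue H h' := by
  obtain ⟨K, hK, hL⟩ := hH
  have h1 := hL (h.1, Γ.endCoord h) (Γ.endCoord_mem h) (h'.1, Γ.endCoord h') (Γ.endCoord_mem h')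
  have h2 := mul_le_mul_of_nonneg_left (HasPath.through h h' hv).pathDist_le hK
  rw [mul_zero] at h2
  exact sub_eq_zero.mp (abs_nonpos_iff.mp (h1.trans h2))

/-- Being attached to some edge is invariant along chains of edges. This makes the minimal degree
positive, as division by it requires. -/
theorem Connected.exists_vertex_eq [Nonempty E] (hΓ : Γ.Connected) (v : V) :
    ∃ h, Γ.vertex h = v := by
  have key : ∀ a b, Relation.EqvGen (fun a b => ∃ e, Γ.endpt e false = a ∧ Γ.endpt e true = b) a b →
      ((∃ h, Γ.vertex h = a) ↔ ∃ h, Γ.vertex h = b) := fun a b hab => by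
    induction hab with
    | rel a b hab =>
      obtain ⟨e, ha, hb⟩ := hab
      exact ⟨fun _ => ⟨(e, true), hb⟩, fun _ => ⟨(e, false), ha⟩⟩
    | refl => exact Iff.rfl
    | symm _ _ _ ih => exact ih.symm
    | trans _ _ _ _ _ ih₁ ih₂ => exact ih₁.trans ih₂
  obtain ⟨e⟩ := ‹Nonempty E›
  exact (key _ _ (hΓ (Γ.endpt e false) v)).mp ⟨(e, false), rfl⟩

theorem Connected.minDegree_pos [Fintype E] [Nonempty E] (hΓ : Γ.Connected) : 0 < Γ.minDegree := by
  obtain ⟨e⟩ := ‹Nonempty E›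
  have : Nonempty V := ⟨Γ.endpt e false⟩
  refine Nat.succ_le_iff.mp (le_ciInf fun v => ?_)
  have : Nonempty E := ⟨e⟩
  obtain ⟨h, hv⟩ := hΓ.exists_vertex_eq v
  exact Finset.card_pos.mpr ⟨h, Γ.mem_star.mpr hv⟩

theorem minDegree_le [Fintype E] (v : V) : Γ.minDegree ≤ Γ.degree v :=
  ciInf_le (OrderBot.bddBelow _) v

theorem lenMin_le [Fintype E] (e : E) : Γ.lenMin ≤ Γ.len e :=
  ciInf_le (finite_range _).bddBelow e

theorem le_lenMax [Fintype E] (e : E) : Γ.len e ≤ Γ.lenMax :=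
  le_ciSup (finite_range _).bddAbove e

theorem lenMin_pos [Fintype E] [Nonempty E] : 0 < Γ.lenMin := by
  obtain ⟨e, he⟩ := exists_eq_ciInf_of_finite (f := Γ.len)
  rw [lenMin, ← he]
  exact Γ.len_pos e

theorem lenMax_pos [Fintype E] [Nonempty E] : 0 < Γ.lenMax := by
  obtain ⟨e⟩ := ‹Nonempty E›
  exact (Γ.len_pos e).trans_le (le_lenMax e)

/-- The assumption on `α` in the form in which it is used. -/
theorem exists_boundary_constant [Fintype E] [Nonempty E] (hΓ : Γ.Connected) {H₀ κ₀ α : ℝ}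
    (hH₀ : 0 < H₀) (hκ₀ : 0 < κ₀)
    (hα : Γ.EdgeLengthCondition (|α| / (Γ.minDegree : ℝ)) κ₀ H₀ ∨ 0 ≤ α) :
    ∃ S, 0 ≤ S ∧ Γ.EdgeLengthCondition S κ₀ H₀ ∧ ∀ v, - S ≤ α / Γ.degree v := by
  have hd : (0 : ℝ) < Γ.minDegree := by exact_mod_cast hΓ.minDegree_pos
  rcases hα with hα | hα
  · refine ⟨_, by positivity, hα, fun v => ?_⟩
    have hv : (Γ.minDegree : ℝ) ≤ Γ.degree v := by exact_mod_cast minDegree_le v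
    have h1 : |α| / (Γ.degree v : ℝ) ≤ |α| / Γ.minDegree := by gcongr
    have h2 : -(|α| / (Γ.degree v : ℝ)) ≤ α / Γ.degree v := by
      rw [← neg_div]
      exact div_le_div_of_nonneg_right (neg_abs_le α) (by positivity)
    linarith
  -- A nonnegative vertex term needs no absorption, and with `S = 0` the length condition is
  -- automatic.
  · refine ⟨0, le_rfl, ⟨by simp; positivity, by simpa using hH₀.le⟩, fun v => ?_⟩
    rw [neg_zero]
    positivity

/-- At `δ = 1` the first inequality has slack but the second may be an equality. Taking `δ` slightly
above `1` lowers `1 + δ⁻¹` below `2` and trades part of the slack for a margin in the second. -/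
theorem EdgeLengthCondition.exists_margin [Fintype E] [Nonempty E] {S κ₀ H₀ : ℝ} (hS : 0 ≤ S)
    (hH₀ : 0 < H₀) (h : Γ.EdgeLengthCondition S κ₀ H₀) :
    ∃ δ > 0, ∃ ε > 0, ∀ e, S * (2 * (1 + δ) / Γ.len e) + ε ≤ κ₀ ^ 2 ∧
      S * ((1 + δ⁻¹) * Γ.len e) + ε ≤ H₀ := by
  obtain ⟨h1, h2⟩ := h
  have ha := lenMin_pos (Γ := Γ)
  have hb := lenMax_pos (Γ := Γ)
  set a := Γ.lenMin
  set b := Γ.lenMax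
  set γ := κ₀ ^ 2 - 4 * S * a⁻¹ with hγ
  have hγpos : 0 < γ := sub_pos.mpr h1
  -- Raising `δ` by `η` costs `2 * S * η / a` in the first inequality, which is at most `γ / 2`; the
  -- `+ 1` covers `S = 0`.
  set η := γ * a / (4 * S + 1) with hη
  have hηpos : 0 < η := by positivity
  have hslack : 0 < H₀ - S * ((1 + (1 + η)⁻¹) * b) := by
    rcases hS.eq_or_lt with hS0 | hS0
    · simpa [← hS0] using hH₀
    · have : (1 + η)⁻¹ < 1 := inv_lt_one_of_one_lt₀ (by linarith)
      have : S * ((1 + (1 + η)⁻¹) * b) < S * ((1 + 1) * b) := by gcongr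
      linarith
  refine ⟨1 + η, by positivity, min (γ / 2) (H₀ - S * ((1 + (1 + η)⁻¹) * b)),
    lt_min (by positivity) hslack, fun e => ⟨?_, ?_⟩⟩
  · have h3 : S * (2 * (1 + (1 + η)) / Γ.len e) ≤ S * (2 * (1 + (1 + η)) / a) := by
      have := lenMin_le (Γ := Γ) e
      gcongr
    have h4 : S * (2 * (1 + (1 + η)) / a) = 4 * S * a⁻¹ + γ * (2 * S / (4 * S + 1)) := by
      rw [hη]; field_simp; ring
    have h5 : 2 * S / (4 * S + 1) ≤ 1 / 2 := by
      rw [div_le_div_iff₀ (by positivity) two_pos]; linarith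
    have h6 := mul_le_mul_of_nonneg_left h5 hγpos.le
    have h7 := min_le_left (γ / 2) (H₀ - S * ((1 + (1 + η)⁻¹) * b))
    linarith
  · have h3 : S * ((1 + (1 + η)⁻¹) * Γ.len e) ≤ S * ((1 + (1 + η)⁻¹) * b) := by
      have := le_lenMax (Γ := Γ) e
      gcongr
    have h7 := min_le_right (γ / 2) (H₀ - S * ((1 + (1 + η)⁻¹) * b))
    linarith

end Geometry

/-! ### Coercivity, density and explicit subspaces. -/

variable {V E : Type*} [Fintype E] (Γ : MetricGraph V E)
variable {H κ : E → ℝ → ℝ} (hH : ∀ e, MemLp (H e) ⊤ (edgeMeasure (Γ.len e)))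
    (hκ : ∀ e, MemLp (fun x => κ e x ^ 2) ⊤ (edgeMeasure (Γ.len e))) {α : ℝ}

/-- On each edge the vertex term is at least `-S` times the sum of the squared end values. The trace
inequality bounds this sum, and the margin keeps a multiple `ε` of both integrals. -/
theorem form_lower_bound [Nonempty E] {H₀ κ₀ S : ℝ} (hH₀ : 0 < H₀) (hκ₀ : 0 < κ₀)
    (hHH₀ : ∀ e, ∀ t ∈ Icc 0 (Γ.len e), H₀ ≤ H e t)
    (hκκ₀ : ∀ e, ∀ᵐ t ∂(edgeMeasure (Γ.len e)), κ₀ ≤ κ e t)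
    (hS : 0 ≤ S) (hSc : Γ.EdgeLengthCondition S κ₀ H₀) (hSα : ∀ v, - S ≤ α / Γ.degree v) :
    ∃ ε > 0, ∀ w : Γ.PreH1, ε * (∑ e, ((∫ x in 0..Γ.len e, Γ.toFun w e x ^ 2) +
      ∫ x in 0..Γ.len e, Γ.slope e w x ^ 2)) ≤ Γ.form hH hκ α w w := by
  obtain ⟨δ, hδ, ε, hε, hm⟩ := hSc.exists_margin hS hH₀
  refine ⟨ε, hε, fun w => ?_⟩
  rw [form_apply, Fintype.sum_prod_type, ← Finset.sum_add_distrib, Finset.mul_sum]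
  refine Finset.sum_le_sum fun e _ => ?_
  have h0 := left_mem_Icc.mpr (Γ.len_nonneg e)
  have h1 := right_mem_Icc.mpr (Γ.len_nonneg e)
  have hw := Γ.isPrimitive_toFun w e
  have hw2 : IntervalIntegrable (fun x => Γ.toFun w e x ^ 2) volume 0 (Γ.len e) :=
    ((hw.continuousOn.pow 2).mono (uIcc_subset_Icc h0 h1)).intervalIntegrable
  have hs2 := hw.intervalIntegrable_sq h0 h1
  have hHs : H₀ * (∫ x in 0..Γ.len e, Γ.slope e w x ^ 2) ≤
      ∫ x in 0..Γ.len e, H e x * Γ.slope e w x * Γ.slope e w x := by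
    rw [← intervalIntegral.integral_const_mul]
    refine intervalIntegral.integral_mono_on (Γ.len_nonneg e) (hs2.const_mul _)
      (Integrable.intervalIntegrable_edge ((MemLp.mul (r := 2) hw.memLp (hH e)).integrable_mul
        hw.memLp) h0 h1) fun x hx => ?_
    rw [mul_assoc, ← sq]
    exact mul_le_mul_of_nonneg_right (hHH₀ e x hx) (sq_nonneg _)
  have hκw : κ₀ ^ 2 * (∫ x in 0..Γ.len e, Γ.toFun w e x ^ 2) ≤
      ∫ x in 0..Γ.len e, κ e x ^ 2 * Γ.toFun w e x * Γ.toFun w e x := by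
    rw [← intervalIntegral.integral_const_mul, ← integral_edgeMeasure (Γ.len_nonneg e),
      ← integral_edgeMeasure (Γ.len_nonneg e)]
    have hw2' : MemLp (Γ.toFun w e) 2 (edgeMeasure (Γ.len e)) := hw.continuousOn.memLp_edge 2
    refine integral_mono_ae (hw2'.integrable_sq.const_mul _)
      ((MemLp.mul (r := 2) hw2' (hκ e)).integrable_mul hw2') ?_
    filter_upwards [hκκ₀ e] with x hx
    rw [mul_assoc, ← sq]
    exact mul_le_mul_of_nonneg_right (pow_le_pow_left₀ hκ₀.le hx 2) (sq_nonneg _)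
  have htr := mul_le_mul_of_nonneg_left (hw.sq_add_sq_le (Γ.len_pos e) hδ) hS
  have hb : -S * (Γ.toFun w e 0 ^ 2 + Γ.toFun w e (Γ.len e) ^ 2) ≤
      ∑ b : Bool, α / Γ.degree (Γ.vertex (e, b)) *
        (Γ.endValue (Γ.toFun w) (e, b) * Γ.endValue (Γ.toFun w) (e, b)) := by
    rw [Fintype.sum_bool]
    simp only [endValue, endCoord, ← sq]
    have b1 := mul_le_mul_of_nonneg_right (hSα (Γ.vertex (e, false))) (sq_nonneg (Γ.toFun w e 0))
    have b2 := mul_le_mul_of_nonneg_right (hSα (Γ.vertex (e, true)))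
      (sq_nonneg (Γ.toFun w e (Γ.len e)))
    linarith
  set A := ∫ x in 0..Γ.len e, Γ.toFun w e x ^ 2
  set D := ∫ x in 0..Γ.len e, Γ.slope e w x ^ 2
  have hA : 0 ≤ A := intervalIntegral.integral_nonneg (Γ.len_nonneg e) fun _ _ => sq_nonneg _
  have hD : 0 ≤ D := intervalIntegral.integral_nonneg (Γ.len_nonneg e) fun _ _ => sq_nonneg _
  have m1 := mul_le_mul_of_nonneg_right (hm e).1 hA
  have m2 := mul_le_mul_of_nonneg_right (hm e).2 hD
  linarith

/-- The Hilbert norm uses initial values instead of the `L₂` norm; the trace inequality with `δ = 1`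
controls them. Together with `form_lower_bound` this gives coercivity. -/
theorem norm_sq_le_sum [Nonempty E] : ∃ M > 0, ∀ w : Γ.PreH1,
    ‖w‖ ^ 2 ≤ M * ∑ e, ((∫ x in 0..Γ.len e, Γ.toFun w e x ^ 2) +
      ∫ x in 0..Γ.len e, Γ.slope e w x ^ 2) := by
  have ha := lenMin_pos (Γ := Γ)
  have hb := lenMax_pos (Γ := Γ)
  refine ⟨4 / Γ.lenMin + 2 * Γ.lenMax + 1, by positivity, fun w => ?_⟩
  rw [norm_preH1_sq, Finset.mul_sum]
  refine Finset.sum_le_sum fun e _ => ?_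
  have htr := (Γ.isPrimitive_toFun w e).sq_add_sq_le (Γ.len_pos e) one_pos
  set A := ∫ x in 0..Γ.len e, Γ.toFun w e x ^ 2
  set D := ∫ x in 0..Γ.len e, Γ.slope e w x ^ 2
  have hA : 0 ≤ A := intervalIntegral.integral_nonneg (Γ.len_nonneg e) fun _ _ => sq_nonneg _
  have hD : 0 ≤ D := intervalIntegral.integral_nonneg (Γ.len_nonneg e) fun _ _ => sq_nonneg _
  have h1 : 2 * (1 + 1) / Γ.len e * A ≤ 4 / Γ.lenMin * A := by
    have h2 : 2 * (1 + 1) / Γ.len e ≤ 4 / Γ.lenMin := by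
      have := lenMin_le (Γ := Γ) e
      norm_num
      gcongr
    gcongr
  have h2 : (1 + 1⁻¹) * Γ.len e * D ≤ 2 * Γ.lenMax * D := by
    have := le_lenMax (Γ := Γ) e
    norm_num
    gcongr
  have h3 : 0 ≤ 4 / Γ.lenMin * D := by positivity
  have h4 : 0 ≤ Γ.lenMax * A := by positivity
  nlinarith [sq_nonneg (Γ.toFun w e (Γ.len e))]

/-- Test functions supported inside one edge belong to the form space, so its image in `L₂(Γ)` is
dense. -/
theorem eq_zero_of_forall_inner_toL2 {f : Γ.L2} (h : ∀ v ∈ Γ.formSpace, ⟪f, Γ.toL2 v⟫_ℝ = 0) :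
    f = 0 := by
  refine PiLp.ext fun e => Lp.ext ?_
  have key := isOpen_Ioo.ae_eq_zero_of_integral_contDiff_smul_eq_zero (U := Ioo 0 (Γ.len e))
    (μ := edgeMeasure (Γ.len e)) (f := f e)
    (((Lp.memLp (f e)).integrable one_le_two).locallyIntegrable.locallyIntegrableOn _)
    fun φ hφ hφc hφs => by
      have hd : IsPrimitive (Γ.len e) φ (deriv φ) := IsPrimitive.of_hasDerivAt
        (fun x => (hφ.differentiable (by simp)).differentiableAt.hasDerivAt)
        (hφ.continuous_deriv (by simp))
      obtain ⟨v, hv, hvf, -, -, hv'⟩ := exists_single hd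
        (image_eq_zero_of_notMem_tsupport fun h => (hφs h).1.false)
        (image_eq_zero_of_notMem_tsupport fun h => (hφs h).2.false)
      have h1 := h v hv
      rw [Γ.inner_toL2_of_single hvf fun e' he' => (hv' e' he').1] at h1
      rw [integral_edgeMeasure (Γ.len_nonneg e)]
      simpa only [smul_eq_mul, mul_comm] using h1
  have hIoo : ∀ᵐ x ∂edgeMeasure (Γ.len e), x ∈ Ioo 0 (Γ.len e) := by
    rw [edgeMeasure, ← restrict_Ioo_eq_restrict_Icc]
    exact ae_restrict_mem measurableSet_Ioo
  filter_upwards [key, hIoo, Lp.coeFn_zero ℝ 2 (edgeMeasure (Γ.len e))] with x hx hx' h0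
  exact (hx hx').trans h0.symm

/-- Evaluation at `N` equidistant points of every edge. -/
theorem exists_node_functional [Nonempty E] {N : ℕ} (hN : 0 < N) :
    ∃ P : Γ.PreH1 →L[ℝ] (Fin (Fintype.card E * N) → ℝ), ∀ w, P w = 0 →
      ∑ e, ∫ x in 0..Γ.len e, Γ.toFun w e x ^ 2 ≤
        (Γ.lenMax / N) ^ 2 * ∑ e, ∫ x in 0..Γ.len e, Γ.slope e w x ^ 2 := by
  let σ : Fin (Fintype.card E * N) ≃ E × Fin N := (Fintype.equivFinOfCardEq (by simp)).symm
  refine ⟨ContinuousLinearMap.pi fun i => Γ.evalAt (σ i).1 ((σ i).2 * (Γ.len (σ i).1 / N)),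
    fun w hw => ?_⟩
  rw [Finset.mul_sum]
  refine Finset.sum_le_sum fun e _ => ?_
  have hNpos : (0 : ℝ) < N := by exact_mod_cast hN
  have hl := Γ.len_pos e
  refine ((Γ.isPrimitive_toFun w e).integral_sq_le_of_nodes hl hN fun j hj => ?_).trans ?_
  · have h1 := congrFun hw (σ.symm (e, ⟨j, hj⟩))
    have hmem : (j : ℝ) * (Γ.len e / N) ∈ Icc 0 (Γ.len e) := by
      refine ⟨by positivity, ?_⟩
      have : (j : ℝ) ≤ N := by exact_mod_cast hj.le
      calc (j : ℝ) * (Γ.len e / N) ≤ N * (Γ.len e / N) := by gcongr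
        _ = Γ.len e := by field_simp
    rw [← Γ.evalAt_apply hmem]
    simpa using h1
  · have := le_lenMax (Γ := Γ) e
    have hD : 0 ≤ ∫ x in 0..Γ.len e, Γ.slope e w x ^ 2 :=
      intervalIntegral.integral_nonneg hl.le fun _ _ => sq_nonneg _
    gcongr

theorem inner_preH1 (w v : Γ.PreH1) :
    ⟪w, v⟫_ℝ = ∑ e, Γ.toFun w e 0 * Γ.toFun v e 0 +
      ∑ e, ∫ x in 0..Γ.len e, Γ.slope e w x * Γ.slope e v x := by
  rw [WithLp.prod_inner_apply, PiLp.inner_apply, PiLp.inner_apply]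
  congr 1
  · refine Finset.sum_congr rfl fun e _ => ?_
    rw [toFun_zero, toFun_zero]
    exact mul_comm _ _
  · exact Finset.sum_congr rfl fun e _ => inner_edge (Γ.len_nonneg e) _ _

/-- The functions `sin (j π x / l)` on one edge. -/
theorem exists_sine_functions (e : E) : ∃ v : ℕ → Γ.PreH1,
    (∀ i, v i ∈ Γ.formSpace) ∧ ∀ i j,
    ⟪Γ.toL2 (v i), Γ.toL2 (v j)⟫_ℝ = (if i = j then Γ.len e / 2 else 0) ∧
    ⟪v i, v j⟫_ℝ = if i = j then ((i + 1) * Real.pi / Γ.len e) ^ 2 * (Γ.len e / 2) else 0 := by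
  have hl := Γ.len_pos e
  have hprim : ∀ j : ℕ, IsPrimitive (Γ.len e) (fun x => Real.sin ((j + 1) * Real.pi / Γ.len e * x))
      fun x => (j + 1) * Real.pi / Γ.len e * Real.cos ((j + 1) * Real.pi / Γ.len e * x) := fun j =>
    IsPrimitive.of_hasDerivAt (fun x => by
      have := ((hasDerivAt_id x).const_mul ((j + 1) * Real.pi / Γ.len e)).sin
      simpa [mul_comm] using this) (by fun_prop)
  have hex := fun j : ℕ => exists_single (hprim j) (by simp) (by
    rw [div_mul_cancel₀ _ hl.ne']
    exact_mod_cast Real.sin_nat_mul_pi (j + 1))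
  choose v hv hvf hvs hvend hv' using hex
  refine ⟨v, hv, fun i j => ⟨?_, ?_⟩⟩
  · rw [Γ.inner_toL2_of_single (hvf j) fun e' he' => (hv' j e' he').1,
      ← (integral_sin_mul_sin_and_cos_mul_cos hl i j).1]
    refine intervalIntegral_congr_edge hl.le ?_
    filter_upwards [Γ.toL2_ae (v i) e, ae_restrict_mem measurableSet_Icc] with x hx hx'
    rw [hx, hvf i x hx']
  · have hinner : ⟪v i, v j⟫_ℝ = ∫ x in 0..Γ.len e,
        ((i + 1) * Real.pi / Γ.len e) * ((j + 1) * Real.pi / Γ.len e) *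
        (Real.cos ((i + 1) * Real.pi / Γ.len e * x) *
          Real.cos ((j + 1) * Real.pi / Γ.len e * x)) := by
      rw [inner_preH1, Finset.sum_eq_zero fun e' _ => ?_, zero_add, Finset.sum_eq_single e]
      · refine intervalIntegral_congr_edge hl.le ?_
        filter_upwards [hvs i, hvs j] with x h1 h2
        rw [h1, h2]; ring
      · intro e' _ he'
        refine intervalIntegral_eq_zero_edge (Γ.len_nonneg e') ?_
        filter_upwards [(hv' i e' he').2] with x hx
        simp [hx]
      · simp
      · have : Γ.toFun (v i) e' 0 = 0 := hvend i (e', false)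
        rw [this, zero_mul]
    rw [hinner, intervalIntegral.integral_const_mul,
      (integral_sin_mul_sin_and_cos_mul_cos hl i j).2]
    split_ifs with h
    · subst h; ring
    · simp

end MetricGraph

/-! ### The form domain and its two-sided spectral bounds. -/

namespace MetricGraph

open scoped InnerProductSpace

variable {V E : Type*} [Fintype E] (Γ : MetricGraph V E)

/-- The form domain as a Hilbert space. -/
def FormDomain : Type _ := Γ.formSpace

noncomputable instance : NormedAddCommGroup Γ.FormDomain :=
  inferInstanceAs (NormedAddCommGroup Γ.formSpace)

noncomputable instance : InnerProductSpace ℝ Γ.FormDomain :=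
  inferInstanceAs (InnerProductSpace ℝ Γ.formSpace)

instance : CompleteSpace Γ.FormDomain := inferInstanceAs (CompleteSpace Γ.formSpace)

/-- The inclusion of the form domain. -/
noncomputable def formIncl : Γ.FormDomain →L[ℝ] Γ.PreH1 := Γ.formSpace.subtypeL

theorem formIncl_mem (u : Γ.FormDomain) : Γ.formIncl u ∈ Γ.formSpace := u.2

theorem inner_formIncl (u v : Γ.FormDomain) : ⟪Γ.formIncl u, Γ.formIncl v⟫_ℝ = ⟪u, v⟫_ℝ := rfl

theorem norm_formIncl (u : Γ.FormDomain) : ‖Γ.formIncl u‖ = ‖u‖ := rfl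

variable {Γ} in
theorem exists_formIncl_eq {w : Γ.PreH1} (hw : w ∈ Γ.formSpace) : ∃ u, Γ.formIncl u = w :=
  ⟨⟨w, hw⟩, rfl⟩

/-- The inclusion of the form domain into `L₂(Γ)`. -/
noncomputable def formToL2 : Γ.FormDomain →L[ℝ] Γ.L2 := Γ.toL2 ∘L Γ.formIncl

theorem formToL2_apply (u : Γ.FormDomain) : Γ.formToL2 u = Γ.toL2 (Γ.formIncl u) := rfl

/-- The form on its domain. -/
noncomputable def formOn {H κ : E → ℝ → ℝ} (hH : ∀ e, MemLp (H e) ⊤ (edgeMeasure (Γ.len e)))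
    (hκ : ∀ e, MemLp (fun x => κ e x ^ 2) ⊤ (edgeMeasure (Γ.len e))) (α : ℝ) :
    Γ.FormDomain →L[ℝ] Γ.FormDomain →L[ℝ] ℝ :=
  (Γ.form hH hκ α).bilinearComp Γ.formIncl Γ.formIncl

variable {H κ : E → ℝ → ℝ} (hH : ∀ e, MemLp (H e) ⊤ (edgeMeasure (Γ.len e)))
    (hκ : ∀ e, MemLp (fun x => κ e x ^ 2) ⊤ (edgeMeasure (Γ.len e))) {α : ℝ}

theorem formOn_apply (u v : Γ.FormDomain) :
    Γ.formOn hH hκ α u v = Γ.form hH hκ α (Γ.formIncl u) (Γ.formIncl v) := rfl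

/-- Lifts an arbitrary eigenbasis of `L` to the form domain, so that min-max bounds hold for every
admissible enumeration of eigenvalues. -/
theorem IsOrderedEigenvalues.exists_isFormEigensystem
    (hHc : ∀ e, ContinuousOn (H e) (Icc 0 (Γ.len e)))
    (hHv : ∀ h h' : E × Bool, Γ.vertex h = Γ.vertex h' → Γ.endValue H h = Γ.endValue H h')
    {ev : ℕ → ℝ} (h : Γ.IsOrderedEigenvalues H κ α ev) :
    ∃ w : ℕ → Γ.FormDomain, IsFormEigensystem Γ.formToL2 (Γ.formOn hH hκ α) ev w ∧
      (Submodule.span ℝ (range fun n => Γ.formToL2 (w n))).topologicalClosure = ⊤ := by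
  obtain ⟨-, b, hb, hspan, heq⟩ := h
  choose w hw hwb hwf using fun n => OperatorEq.exists_weak Γ hH hκ hHc hHv (heq n)
  choose u hu using fun n => exists_formIncl_eq (hw n)
  have hJ : ∀ n, Γ.formToL2 (u n) = b n := fun n => by rw [formToL2_apply, hu, hwb]
  refine ⟨u, ⟨?_, fun n v => ?_⟩, ?_⟩
  · simpa only [hJ] using hb
  · rw [hJ, ← real_inner_smul_left, formOn_apply, hu, formToL2_apply]
    exact hwf n _ (Γ.formIncl_mem v)
  · simpa only [hJ] using hspan

theorem isOrderedEigenvalues_of_isFormEigensystem {H₀ : ℝ} (hH₀ : 0 < H₀)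
    (hHH₀ : ∀ e, ∀ t ∈ Icc 0 (Γ.len e), H₀ ≤ H e t)
    (hHl : ∀ e, ∃ K : NNReal, LipschitzOnWith K (H e) (Icc 0 (Γ.len e)))
    (hHv : ∀ h h' : E × Bool, Γ.vertex h = Γ.vertex h' → Γ.endValue H h = Γ.endValue H h')
    {ev : ℕ → ℝ} {w : ℕ → Γ.FormDomain}
    (h : IsFormEigensystem Γ.formToL2 (Γ.formOn hH hκ α) ev w) (hmono : Monotone ev)
    (hspan : (Submodule.span ℝ (range fun n => Γ.formToL2 (w n))).topologicalClosure = ⊤) :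
    Γ.IsOrderedEigenvalues H κ α ev :=
  ⟨hmono, fun n => Γ.formToL2 (w n), h.orthonormal, hspan, fun n =>
    Γ.operatorEq_of_weak hH hκ hH₀ hHH₀ hHl hHv (Γ.formIncl_mem (w n)) fun v hv => by
      obtain ⟨u, rfl⟩ := exists_formIncl_eq hv
      rw [real_inner_smul_left]
      exact h.form_eq n u⟩

/-- The form is bounded below by `c n²` on a subspace of codimension less than `n`. -/
theorem exists_lower_bound_codim [Nonempty E] {ε : ℝ} (hε : 0 < ε)
    (hform : ∀ w : Γ.PreH1, ε * (∑ e, ((∫ x in 0..Γ.len e, Γ.toFun w e x ^ 2) +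
      ∫ x in 0..Γ.len e, Γ.slope e w x ^ 2)) ≤ Γ.form hH hκ α w w) :
    ∃ c > 0, ∀ n : ℕ, 1 ≤ n → ∃ m < n, ∃ P : Γ.FormDomain →L[ℝ] (Fin m → ℝ),
      ∀ u, P u = 0 → c * (n : ℝ) ^ 2 * ‖Γ.formToL2 u‖ ^ 2 ≤ Γ.formOn hH hκ α u u := by
  have hb := lenMax_pos (Γ := Γ)
  set b := Γ.lenMax
  set k := Fintype.card E
  have hkpos : 0 < k := Fintype.card_pos
  have hk : (0 : ℝ) < k := by exact_mod_cast hkpos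
  -- The first constant serves `n ≤ k`, where coercivity alone suffices; the second serves `n > k`,
  -- where nodes are used.
  refine ⟨min (ε / k ^ 2) (ε / (4 * k ^ 2 * b ^ 2)), lt_min (by positivity) (by positivity),
    fun n hn => ?_⟩
  have hsq : ∀ w : Γ.PreH1, ε * ‖Γ.toL2 w‖ ^ 2 +
      ε * ∑ e, ∫ x in 0..Γ.len e, Γ.slope e w x ^ 2 ≤ Γ.form hH hκ α w w := fun w => by
    rw [norm_toL2_sq, ← mul_add, ← Finset.sum_add_distrib]
    exact hform w
  have hD : ∀ w : Γ.PreH1, 0 ≤ ∑ e, ∫ x in 0..Γ.len e, Γ.slope e w x ^ 2 := fun w =>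
    Finset.sum_nonneg fun e _ => intervalIntegral.integral_nonneg (Γ.len_nonneg e)
      fun _ _ => sq_nonneg _
  rcases le_or_gt n k with hnk | hnk
  · refine ⟨0, hn, 0, fun u _ => ?_⟩
    have hnk' : (n : ℝ) ≤ k := by exact_mod_cast hnk
    have h1 : min (ε / k ^ 2) (ε / (4 * k ^ 2 * b ^ 2)) * (n : ℝ) ^ 2 ≤ ε := by
      calc _ ≤ ε / k ^ 2 * (k : ℝ) ^ 2 := by
            gcongr; exact min_le_left _ _
        _ = ε := by field_simp
    calc _ ≤ ε * ‖Γ.formToL2 u‖ ^ 2 := mul_le_mul_of_nonneg_right h1 (sq_nonneg _)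
      _ ≤ ε * ‖Γ.formToL2 u‖ ^ 2 + ε * ∑ e, ∫ x in 0..Γ.len e, Γ.slope e (Γ.formIncl u) x ^ 2 :=
        le_add_of_nonneg_right (mul_nonneg hε.le (hD _))
      _ ≤ _ := hsq _
  -- The largest number of nodes per edge with fewer than `n` conditions in total. As `N ≥ 1`,
  -- rounding down loses at most a factor `2`.
  · set N := (n - 1) / k with hN
    have hN1 : 0 < N := Nat.div_pos (by omega) hkpos
    have hkN : k * N ≤ n - 1 := Nat.mul_div_le _ _
    have hn2 : n ≤ 2 * (k * N) := by
      have h1 : n - 1 < k * (N + 1) := by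
        rw [hN]; exact Nat.lt_mul_div_succ _ hkpos
      have h2 : k ≤ k * N := Nat.le_mul_of_pos_right k hN1
      rw [mul_add] at h1
      omega
    obtain ⟨P, hP⟩ := Γ.exists_node_functional hN1
    refine ⟨k * N, by omega, P ∘L Γ.formIncl, fun u hu => ?_⟩
    have hNr : (0 : ℝ) < N := by exact_mod_cast hN1
    have hn2' : (n : ℝ) ≤ 2 * (k * N) := by exact_mod_cast hn2
    have h1 := hP (Γ.formIncl u) hu
    rw [← norm_toL2_sq, ← formToL2_apply] at h1
    set D := ∑ e, ∫ x in 0..Γ.len e, Γ.slope e (Γ.formIncl u) x ^ 2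
    have h2 : min (ε / k ^ 2) (ε / (4 * k ^ 2 * b ^ 2)) * (n : ℝ) ^ 2 ≤ ε * (N / b) ^ 2 := by
      calc _ ≤ ε / (4 * k ^ 2 * b ^ 2) * (2 * (k * N) : ℝ) ^ 2 := by
            gcongr; exact min_le_right _ _
        _ = ε * (N / b) ^ 2 := by field_simp; ring
    calc _ ≤ ε * (N / b) ^ 2 * ‖Γ.formToL2 u‖ ^ 2 := mul_le_mul_of_nonneg_right h2 (sq_nonneg _)
      _ ≤ ε * (N / b) ^ 2 * ((b / N) ^ 2 * D) := by gcongr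
      _ = ε * D := by field_simp
      _ ≤ ε * ‖Γ.formToL2 u‖ ^ 2 + ε * D := le_add_of_nonneg_left (by positivity)
      _ ≤ _ := hsq _

/-- The form is bounded above by `C n²` on an `n`-dimensional subspace. -/
theorem exists_upper_bound_dim [Nonempty E] (B : Γ.FormDomain →L[ℝ] Γ.FormDomain →L[ℝ] ℝ) :
    ∃ C > 0, ∀ n : ℕ, ∃ Φ : (Fin n → ℝ) →ₗ[ℝ] Γ.FormDomain, (∀ x, Γ.formToL2 (Φ x) = 0 → x = 0) ∧
      ∀ x, B (Φ x) (Φ x) ≤ C * (n : ℝ) ^ 2 * ‖Γ.formToL2 (Φ x)‖ ^ 2 := by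
  obtain ⟨e⟩ := ‹Nonempty E›
  have hl := Γ.len_pos e
  obtain ⟨w, hw, hv⟩ := Γ.exists_sine_functions e
  choose v hvw using fun i => exists_formIncl_eq (hw i)
  -- The sines vanish at the initial points, so their Hilbert norm is the `L₂` norm of the
  -- derivative, at most `π n / l` times their own `L₂` norm. The `+ 1` makes the constant positive.
  refine ⟨(‖B‖ + 1) * (Real.pi / Γ.len e) ^ 2, by positivity, fun n => ?_⟩
  let Φ : (Fin n → ℝ) →ₗ[ℝ] Γ.FormDomain := Fintype.linearCombination ℝ fun i : Fin n => v i
  have hJ : ∀ x, ‖Γ.formToL2 (Φ x)‖ ^ 2 = ∑ i, x i ^ 2 * (Γ.len e / 2) := fun x => by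
    have h1 : Γ.formToL2 (Φ x) = ∑ i, x i • Γ.formToL2 (v i) := by
      simp only [Φ, Fintype.linearCombination_apply, map_sum, map_smul]
    rw [h1]
    exact norm_sq_sum_smul_of_orthogonal (fun i j => by
      rw [formToL2_apply, formToL2_apply, hvw, hvw]
      simpa only [Fin.ext_iff] using (hv i j).1) x
  have hW : ∀ x, ‖Φ x‖ ^ 2 =
      ∑ i : Fin n, x i ^ 2 * (((i + 1) * Real.pi / Γ.len e) ^ 2 * (Γ.len e / 2)) := fun x => by
    simp only [Φ, Fintype.linearCombination_apply]
    exact norm_sq_sum_smul_of_orthogonal (a := fun i : Fin n =>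
      (((i : ℕ) + 1) * Real.pi / Γ.len e) ^ 2 * (Γ.len e / 2)) (fun i j => by
      rw [← inner_formIncl, hvw, hvw]
      simpa only [Fin.ext_iff] using (hv i j).2) x
  refine ⟨Φ, fun x hx => ?_, fun x => ?_⟩
  · have h1 := hJ x
    rw [hx, norm_zero, zero_pow two_ne_zero, eq_comm,
      Finset.sum_eq_zero_iff_of_nonneg fun i _ => by positivity] at h1
    funext i
    have h2 := h1 i (Finset.mem_univ i)
    have h3 : Γ.len e / 2 ≠ 0 := by positivity
    simpa [h3, hl.ne'] using h2
  · have h1 : ‖Φ x‖ ^ 2 ≤ (Real.pi / Γ.len e) ^ 2 * (n : ℝ) ^ 2 * ‖Γ.formToL2 (Φ x)‖ ^ 2 := by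
      rw [hW, hJ, Finset.mul_sum]
      refine Finset.sum_le_sum fun i _ => ?_
      have hi : ((i : ℕ) : ℝ) + 1 ≤ n := by exact_mod_cast i.2
      calc _ ≤ x i ^ 2 * ((n * Real.pi / Γ.len e) ^ 2 * (Γ.len e / 2)) := by
            have := Real.pi_pos
            gcongr
        _ = _ := by ring
    calc B (Φ x) (Φ x) ≤ ‖B‖ * ‖Φ x‖ * ‖Φ x‖ := (le_abs_self _).trans (B.le_opNorm₂ _ _)
      _ = ‖B‖ * ‖Φ x‖ ^ 2 := by ring
      _ ≤ (‖B‖ + 1) * ((Real.pi / Γ.len e) ^ 2 * (n : ℝ) ^ 2 * ‖Γ.formToL2 (Φ x)‖ ^ 2) := by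
        gcongr
        linarith
      _ = _ := by ring

end MetricGraph

/-! ### Existence of the eigenbasis and quadratic growth. -/

theorem mainTheorem3 {V E : Type*} [Finite V] [Fintype E] [Nonempty E]
    (Γ : MetricGraph V E) (hconn : Γ.Connected)
    (H κ : E → ℝ → ℝ) (H₀ κ₀ α : ℝ)
    (hH : Γ.IsLipschitz H) (hH₀ : 0 < H₀) (hHH₀ : ∀ e, ∀ t ∈ Set.Icc 0 (Γ.len e), H₀ ≤ H e t)
    (hκ : ∀ e, MeasureTheory.MemLp (κ e) ⊤ (edgeMeasure (Γ.len e))) (hκ₀ : 0 < κ₀)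
    (hκκ₀ : ∀ e, ∀ᵐ t ∂(edgeMeasure (Γ.len e)), κ₀ ≤ κ e t)
    (hα : Γ.EdgeLengthCondition (|α| / (Γ.minDegree : ℝ)) κ₀ H₀ ∨ 0 ≤ α) :
    (∃ ev : ℕ → ℝ, Γ.IsOrderedEigenvalues H κ α ev) ∧
    ∃ C₁ > 0, ∃ C₂ > 0, ∀ ev : ℕ → ℝ, Γ.IsOrderedEigenvalues H κ α ev →
      ∀ n : ℕ, 1 ≤ n → C₁ * (n : ℝ) ^ 2 ≤ ev (n - 1) ∧ ev (n - 1) ≤ C₂ * (n : ℝ) ^ 2 := by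
  have hHl := hH.lipschitzOnWith
  have hHv : ∀ h h' : E × Bool, Γ.vertex h = Γ.vertex h' → Γ.endValue H h = Γ.endValue H h' :=
    fun _ _ => hH.endValue_eq
  have hHc : ∀ e, ContinuousOn (H e) (Icc 0 (Γ.len e)) := fun e =>
    (hHl e).elim fun _ hK => hK.continuousOn
  have hHm : ∀ e, MemLp (H e) ⊤ (edgeMeasure (Γ.len e)) := fun e => (hHc e).memLp_edge ⊤
  have hκm : ∀ e, MemLp (fun x => κ e x ^ 2) ⊤ (edgeMeasure (Γ.len e)) := fun e => by
    have := MemLp.mul (r := ⊤) (hκ e) (hκ e)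
    rwa [← sq] at this
  obtain ⟨S, hS, hSc, hSα⟩ := MetricGraph.exists_boundary_constant hconn hH₀ hκ₀ hα
  obtain ⟨ε, hε, hform⟩ := Γ.form_lower_bound hHm hκm hH₀ hκ₀ hHH₀ hκκ₀ hS hSc hSα
  obtain ⟨M, hM, hnorm⟩ := Γ.norm_sq_le_sum
  set B := Γ.formOn hHm hκm α
  have hsymm : ∀ u v, B u v = B v u := fun u v => Γ.form_comm hHm hκm α _ _
  have hcoer : IsCoercive B := by
    refine ⟨ε / M, by positivity, fun u => ?_⟩
    have h1 := mul_le_mul_of_nonneg_left (hnorm (Γ.formIncl u)) (div_pos hε hM).le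
    rw [← mul_assoc, div_mul_cancel₀ _ hM.ne', Γ.norm_formIncl, sq, ← mul_assoc] at h1
    exact h1.trans (hform _)
  have hpos : ∀ u, 0 ≤ B u u := fun u => by
    obtain ⟨C, hC, h⟩ := hcoer
    exact le_trans (by positivity) (h u)
  obtain ⟨c, hc, hlow⟩ := Γ.exists_lower_bound_codim hHm hκm hε hform
  obtain ⟨C, hC, hup⟩ := Γ.exists_upper_bound_dim B
  -- The sine spaces embed in `L₂(Γ)` in every dimension, in particular in one more than its
  -- supposed dimension.
  have hinf : ¬ FiniteDimensional ℝ Γ.L2 := fun hfin => by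
    obtain ⟨Φ, hΦ, -⟩ := hup (Module.finrank ℝ Γ.L2 + 1)
    have h1 := LinearMap.finrank_le_finrank_of_injective
      (f := Γ.formToL2.toLinearMap ∘ₗ Φ) (by
        rw [← LinearMap.ker_eq_bot, Submodule.eq_bot_iff]
        exact hΦ)
    simp at h1
  refine ⟨?_, c, hc, C, hC, fun ev hev n hn => ?_⟩
  · obtain ⟨ev, w, hw, hmono, hspan⟩ := exists_isFormEigensystem hsymm hcoer
      (fun f hf => Γ.eq_zero_of_forall_inner_toL2 fun v hv => by
        obtain ⟨u, rfl⟩ := MetricGraph.exists_formIncl_eq hv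
        exact hf u) hc hlow hinf
    exact ⟨ev, Γ.isOrderedEigenvalues_of_isFormEigensystem hHm hκm hH₀ hHH₀ hHl hHv hw hmono hspan⟩
  · obtain ⟨w, hw, hspan⟩ := hev.exists_isFormEigensystem Γ hHm hκm hHc hHv
    obtain ⟨m, hm, P, hP⟩ := hlow n hn
    obtain ⟨Φ, hΦ, hΦB⟩ := hup n
    exact ⟨hw.le_ev hev.1 P.toLinearMap (by simpa using hm) hP,
      hw.ev_le hev.1 hspan hsymm hpos hn Φ hΦ hΦB⟩
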